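/- **Setting.** Let $\sigma$ be a finite Borel measure on $\mathbb R$ and let $\lambda_0,\lambda_1,\dots\in\mathbb R$ be such that the exponentials $e_{\lambda_n}(u)=e^{i\lambda_n u}$, $n=0,1,\dots$, form an orthonormal basis of the complex space $L^2(d\sigma)$. Let $h_0,h_1,\dots$ be the Hermite functions, an orthonormal basis of $L^2(\mathbb R,dx)$; let $\hat f(u)=\int e^{iux}f(x)\,dx$, and for $f\in L^1(\mathbb R,dx)$ let $Q_\sigma f=\sum_n\langle \hat f,e_{\lambda_n}\rangle_{L^2(d\sigma)}\,h_n$, that is, the image of $\hat f$ under the unitary map $L^2(d\sigma)\to L^2(\mathbb R,dx)$, $e_{\lambda_n}\mapsto h_n$. Let $P$ be the white noise measure on the dual $\mathscr S'$ of the space $\mathscr S$ of real Schwartz functions, i.e. the Borel probability measure with $\int_{\mathscr S'}e^{-i\langle\omega,s\rangle}dP(\omega)=e^{-\|s\|^2/2}$ for $s\in\mathscr S$ ($\|\cdot\|$ the norm of $L^2(\mathbb R,dx)$), let $\mathcal W=L^2(\mathscr S',P)$ with complex scalars, and let $f\mapsto\tilde f$ be the continuous complex-linear extension to $L^2(\mathbb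 R,dx)$ of $s\mapsto\langle\cdot,s\rangle\in\mathcal W$. Put $$X_\sigma(t)=\widetilde{Q_\sigma 1_{[0,t]}}\in\mathcal W\qquad(1_{[0,t]}:=-1_{[t,0]}\ \text{for } t<0),$$ and let $W_\sigma(t)\in\mathcal W$ be the derivative of $t\mapsto X_\sigma(t)$ in the norm of $\mathcal W$. For finitely supported $\alpha=(\alpha_0,\alpha_1,\dots)$ with entries in $\mathbb N_0$ let $H_\alpha(\omega)=\prod_k \mathbf h_{\alpha_k}(\langle\omega,h_k\rangle)$ ($\mathbf h_m$ the probabilists' Hermite polynomials), $\alpha!=\prod_k\alpha_k!$ and $(2\mathbb N)^{\alpha}=\prod_k(2(k+1))^{\alpha_k}$. Elements $F$ of $\mathcal W$ are identified with the formal series $\sum_\alpha f_\alpha H_\alpha$, $f_\alpha=E[FH_\alpha]/\alpha!$. The Wick product of formal series is determined by $H_\alpha\lozenge H_\beta=H_{\alpha+\beta}$. For $p\in\mathbb N$ let $\mathcal H_p'$ be the Hilbert space of formal series $f=\sum_\alpha f_\alpha H_\alpha$ ($f_\alpha\in\mathbb C$) with $\|f\|_p^2=\sum_\alpha|f_\alpha|^2(2\mathbb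 N)^{-p\alpha}<\infty$. Let $S_{-1}=\bigcup_{p\ge1}\mathcal H_p'$, with its strong topology as the dual, through $\langle f,g\rangle=\sum_\alpha \alpha!\,f_\alpha g_\alpha$, of the countably normed space $S_1$ of all series $g$ with $\sum_\alpha(\alpha!)^2|g_\alpha|^2(2\mathbb N)^{k\alpha}<\infty$ for every $k$: the topology of uniform convergence on the bounded subsets of $S_1$. **Theorem 7.1.** Let $a\le b$ and let $Y:[a,b]\to S_{-1}$ be continuous for the strong topology of $S_{-1}$. Then there is a $p\in\mathbb N$, $p\ge1$, such that $t\mapsto Y(t)\lozenge W_\sigma(t)$ is an $\mathcal H_p'$-valued function on $[a,b]$, continuous for the norm of $\mathcal H'_p$ (so that its Riemann integral over $[a,b]$ exists in $\mathcal H_p'$), and $$\int_a^b Y(t)\lozenge W_\sigma(t)\,dt=\lim_{|\Delta|\to0}\ \sum_{k=0}^{n-1}Y(t_k)\lozenge\bigl(X_\sigma(t_{k+1})-X_\sigma(t_k)\bigr)$$ in the norm of $\mathcal H_p'$, all the terms of the sums lying in $\mathcal H_p'$. The limit is over the partitions $\Delta: a=t_0<t_1<\dots<t_n=b$, with $|\Delta|=\max_{0\le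 k\le n-1}(t_{k+1}-t_k)$: for every $\varepsilon>0$ there is a $\delta>0$ such that for every partition with $|\Delta|<\delta$ the sum differs from the integral by less than $\varepsilon$ in the norm of $\mathcal H_p'$. -/

import Mathlib

open MeasureTheory ProbabilityTheory Filter
open scoped SchwartzMap ENNReal NNReal

noncomputable section

namespace KondratievIto

/-! ### Hermite functions -/

theorem iteratedDeriv_poly_gaussian (n : ℕ) (p : Polynomial ℝ) : ∃ q : Polynomial ℝ,
    iteratedDeriv n (fun x : ℝ => p.eval x * Real.exp (-(x ^ 2 / 2))) =
      fun x : ℝ => q.eval x * Real.exp (-(x ^ 2 / 2)) := by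
  induction n with
  | zero => exact ⟨p, by simp⟩
  | succ n ih =>
    obtain ⟨q, hq⟩ := ih
    refine ⟨q.derivative - Polynomial.X * q, ?_⟩
    rw [iteratedDeriv_succ, hq]
    funext x
    have h1 : HasDerivAt (fun x : ℝ => Real.exp (-(x ^ 2 / 2)))
        (Real.exp (-(x ^ 2 / 2)) * (-x)) x := by
      have h0 : HasDerivAt (fun x : ℝ => -(x ^ 2 / 2)) (-x) x := by
        have := ((hasDerivAt_pow 2 x).div_const 2).neg
        refine this.congr_deriv ?_
        norm_num
      exact h0.exp
    have h2 := (q.hasDerivAt x).mul h1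
    have h3 := h2.deriv
    simp only [Polynomial.eval_sub, Polynomial.eval_mul, Polynomial.eval_X]
    refine Eq.trans ?_ (h3.trans ?_)
    · rfl
    · ring

theorem poly_gaussian_bounded (p : Polynomial ℝ) :
    ∃ C : ℝ, ∀ x : ℝ, |p.eval x * Real.exp (-(x ^ 2 / 2))| ≤ C := by
  induction p using Polynomial.induction_on' with
  | add p q hp hq =>
    obtain ⟨C, hC⟩ := hp
    obtain ⟨D, hD⟩ := hq
    refine ⟨C + D, fun x => ?_⟩
    rw [Polynomial.eval_add, add_mul]
    exact (abs_add_le _ _).trans (add_le_add (hC x) (hD x))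
  | monomial n c =>
    refine ⟨|c| * (1 + 2 ^ n * n.factorial), fun x => ?_⟩
    have he := Real.exp_pos (-(x ^ 2 / 2))
    rw [Polynomial.eval_monomial, abs_mul, abs_mul, mul_assoc, abs_of_pos he, abs_pow]
    refine mul_le_mul_of_nonneg_left ?_ (abs_nonneg c)
    have h1 : |x| ^ n ≤ 1 + (x ^ 2) ^ n := by
      have h4 : (x ^ 2) ^ n = (|x| ^ n) ^ 2 := by rw [← sq_abs, ← pow_mul, ← pow_mul, mul_comm]
      rw [h4]
      nlinarith [sq_nonneg (|x| ^ n - 1), sq_nonneg (|x| ^ n)]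
    have h2 := Real.pow_div_factorial_le_exp (x ^ 2 / 2) (by positivity) n
    have hf : (0 : ℝ) < n.factorial := by positivity
    rw [div_le_iff₀ hf, div_pow, div_le_iff₀ (by positivity)] at h2
    have h3 : Real.exp (x ^ 2 / 2) * Real.exp (-(x ^ 2 / 2)) = 1 := by
      rw [← Real.exp_add]; simp
    have h5 : Real.exp (-(x ^ 2 / 2)) ≤ 1 := by
      rw [Real.exp_le_one_iff]; nlinarith [sq_nonneg x]
    calc |x| ^ n * Real.exp (-(x ^ 2 / 2))
        ≤ (1 + (x ^ 2) ^ n) * Real.exp (-(x ^ 2 / 2)) := by gcongr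
      _ = Real.exp (-(x ^ 2 / 2)) + (x ^ 2) ^ n * Real.exp (-(x ^ 2 / 2)) := by ring
      _ ≤ 1 + (Real.exp (x ^ 2 / 2) * n.factorial * 2 ^ n) * Real.exp (-(x ^ 2 / 2)) := by
          gcongr
      _ = 1 + 2 ^ n * n.factorial := by linear_combination (n.factorial * 2 ^ n : ℝ) * h3

/-- A polynomial times `exp (-x² / 2)`, as a real Schwartz function. -/
def polyGaussian (p : Polynomial ℝ) : 𝓢(ℝ, ℝ) where
  toFun x := p.eval x * Real.exp (-(x ^ 2 / 2))
  smooth' := by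
    have : ContDiff ℝ (⊤ : ℕ∞) (fun x : ℝ => p.eval x) := by
      simpa using (p.contDiff_aeval (𝕜 := ℝ) (⊤ : ℕ∞))
    fun_prop
  decay' k n := by
    obtain ⟨q, hq⟩ := iteratedDeriv_poly_gaussian n p
    obtain ⟨C, hC⟩ := poly_gaussian_bounded (Polynomial.X ^ k * q)
    refine ⟨C, fun x => ?_⟩
    rw [norm_iteratedFDeriv_eq_norm_iteratedDeriv, hq]
    have := hC x
    rw [Polynomial.eval_mul, Polynomial.eval_pow, Polynomial.eval_X, mul_assoc, abs_mul,
      abs_pow] at this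
    simpa [Real.norm_eq_abs] using this

/-- The `n`-th Hermite function
`h_n(x) = (√π n!)^{-1/2} He_n(√2 x) e^{-x²/2}`, where `He_n` is the probabilists' Hermite
polynomial; equivalently `(√π 2ⁿ n!)^{-1/2} H_n(x) e^{-x²/2}` with the physicists' `H_n`. -/
def hermiteFun (n : ℕ) : 𝓢(ℝ, ℝ) :=
  polyGaussian (Polynomial.C (Real.sqrt (Real.sqrt Real.pi * n.factorial))⁻¹ *
    ((Polynomial.hermite n).map (Int.castRingHom ℝ)).comp
      (Polynomial.C (Real.sqrt 2) * Polynomial.X))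

theorem hermiteFun_apply (n : ℕ) (x : ℝ) :
    hermiteFun n x = (Real.sqrt (Real.sqrt Real.pi * n.factorial))⁻¹ *
      Polynomial.aeval (Real.sqrt 2 * x) (Polynomial.hermite n) * Real.exp (-(x ^ 2 / 2)) := by
  change Polynomial.eval x (_ : Polynomial ℝ) * Real.exp (-(x ^ 2 / 2)) = _
  simp [Polynomial.eval_map, Polynomial.aeval_def]

/-- `h_n` as an element of the complex space `L²(ℝ, dx)`. -/
def hermiteL2 (n : ℕ) : Lp ℂ 2 (volume : Measure ℝ) :=
  Complex.ofRealCLM.compLpL 2 volume ((hermiteFun n).toLp 2 volume)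

/-! ### White noise space -/

/-- `Ω = 𝓢'`, the dual of the space of real Schwartz functions. -/
abbrev TemperedDual : Type := 𝓢(ℝ, ℝ) →L[ℝ] ℝ

instance : MeasurableSpace TemperedDual := borel _

/-- `P` is the white noise probability measure on `𝓢'`, i.e. the Borel probability measure with
characteristic functional `s ↦ exp (-‖s‖² / 2)`, `‖·‖` the norm of `L²(ℝ, dx)`. -/
class IsWhiteNoise (P : Measure TemperedDual) : Prop extends IsProbabilityMeasure P where
  charFunctional : ∀ s : 𝓢(ℝ, ℝ),
    ∫ w : TemperedDual, Complex.exp (-(Complex.I * (w s : ℂ))) ∂P =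
      Complex.exp (-((∫ x : ℝ, (s x) ^ 2 : ℝ) : ℂ) / 2)

theorem measurable_eval (s : 𝓢(ℝ, ℝ)) : Measurable (fun w : TemperedDual => w s) := by
  have : BorelSpace TemperedDual := ⟨rfl⟩
  exact (ContinuousEvalConst.continuous_eval_const s).measurable

section WhiteNoise

variable (P : Measure TemperedDual) [IsWhiteNoise P]

theorem map_eval_eq_gaussian (s : 𝓢(ℝ, ℝ)) :
    P.map (fun w : TemperedDual => w s) = gaussianReal 0 (∫ x : ℝ, (s x) ^ 2).toNNReal := by
  have : IsProbabilityMeasure (P.map (fun w : TemperedDual => w s)) :=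
    Measure.isProbabilityMeasure_map (measurable_eval s).aemeasurable
  refine Measure.ext_of_charFun ?_
  funext t
  rw [charFun_gaussianReal, charFun_apply_real,
    integral_map (measurable_eval s).aemeasurable (by fun_prop)]
  have h := IsWhiteNoise.charFunctional (P := P) ((-t) • s)
  have h0 : 0 ≤ ∫ x : ℝ, (s x) ^ 2 := integral_nonneg fun x => sq_nonneg _
  have h1 : ∫ x : ℝ, (((-t) • s) x) ^ 2 = t ^ 2 * ∫ x : ℝ, (s x) ^ 2 := by
    rw [← integral_const_mul]
    congr 1
    funext x
    simp only [smul_apply, smul_eq_mul]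
    ring
  rw [h1] at h
  convert h using 2
  · funext w
    congr 1
    simp only [map_smul, smul_eq_mul]
    push_cast
    ring
  · rw [show (((∫ x : ℝ, (s x) ^ 2).toNNReal : ℝ≥0) : ℂ) = ((∫ x : ℝ, (s x) ^ 2 : ℝ) : ℂ) from by
      exact_mod_cast congrArg Complex.ofReal (Real.coe_toNNReal _ h0)]
    push_cast
    ring

theorem memLp_eval (s : 𝓢(ℝ, ℝ)) : MemLp (fun w : TemperedDual => w s) 2 P := by
  have h : MemLp id 2 (P.map (fun w : TemperedDual => w s)) := by
    rw [map_eval_eq_gaussian]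
    exact memLp_id_gaussianReal' 2 (by simp)
  exact (memLp_map_measure_iff (by fun_prop) (measurable_eval s).aemeasurable).1 h

/-- The map `s ↦ s̃`, `s̃(ω) = ⟨ω, s⟩`, from real Schwartz functions to `L²(𝓢', P)`. -/
def tildeSchwartz : 𝓢(ℝ, ℝ) →ₗ[ℝ] Lp ℝ 2 P where
  toFun s := (memLp_eval P s).toLp
  map_add' s₁ s₂ := by
    rw [← MemLp.toLp_add]
    exact MemLp.toLp_congr _ _ (Eventually.of_forall fun w => map_add w s₁ s₂)
  map_smul' c s := by
    rw [RingHom.id_apply, ← MemLp.toLp_const_smul]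
    exact MemLp.toLp_congr _ _ (Eventually.of_forall fun w => map_smul w c s)

/-- The continuous extension `f ↦ f̃` of `tildeSchwartz` to the real space `L²(ℝ, dx)`. -/
def tilde : Lp ℝ 2 (volume : Measure ℝ) →L[ℝ] Lp ℝ 2 P :=
  (tildeSchwartz P).extendOfNorm (SchwartzMap.toLpCLM ℝ ℝ 2 (volume : Measure ℝ)).toLinearMap

/-- The complex-linear extension `f ↦ (Re f)~ + i (Im f)~` to the complex space `L²(ℝ, dx)`. -/
def tildeC (f : Lp ℂ 2 (volume : Measure ℝ)) : Lp ℂ 2 P :=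
  Complex.ofRealCLM.compLpL 2 P (tilde P (Complex.reCLM.compLpL 2 volume f)) +
    Complex.I • Complex.ofRealCLM.compLpL 2 P (tilde P (Complex.imCLM.compLpL 2 volume f))

end WhiteNoise

/-! ### Chaos expansions and Kondratiev spaces

Multi-indices are finitely supported `α : ℕ →₀ ℕ`; the entry `α k` (with `k = 0, 1, …`) is attached
to the Hermite function `h_k` and to the weight `2 (k + 1)`. -/

/-- Formal series `∑_α f_α H_α`, given by their complex coefficients. -/
abbrev ChaosSeries : Type := (ℕ →₀ ℕ) → ℂ

/-- `α! = ∏ α_k!` -/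
def multiFactorial (α : ℕ →₀ ℕ) : ℝ := α.prod fun _ m => (m.factorial : ℝ)

/-- `(2ℕ)^α = ∏ (2 (k + 1))^{α_k}` -/
def twoN (α : ℕ →₀ ℕ) : ℝ := α.prod fun k m => (2 * ((k : ℝ) + 1)) ^ m

theorem twoN_pos (α : ℕ →₀ ℕ) : 0 < twoN α :=
  Finset.prod_pos fun _ _ => by positivity

/-- `H_α(ω) = ∏_k He_{α_k}(⟨ω, h_k⟩)`, with the probabilists' Hermite polynomials. -/
def hermiteChaos (α : ℕ →₀ ℕ) (w : TemperedDual) : ℝ :=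
  α.prod fun k m => Polynomial.aeval (w (hermiteFun k)) (Polynomial.hermite m)

/-- The coefficients `E[F H_α] / α!` of `F ∈ 𝒲 = L²(𝓢', P)` in the orthogonal basis `H_α`. This is
the inclusion of `𝒲` into the formal series. -/
def chaosCoeff (P : Measure TemperedDual) (F : Lp ℂ 2 P) : ChaosSeries := fun α =>
  (∫ w, F w * (hermiteChaos α w : ℂ) ∂P) / (multiFactorial α : ℂ)

/-- The Wick product of formal series, `H_α ◇ H_β = H_{α+β}`. -/
def wick (f g : ChaosSeries) : ChaosSeries := fun γ =>
  ∑ q ∈ Finset.HasAntidiagonal.antidiagonal γ, f q.1 * g q.2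

/-- The space `𝓗_p'` of formal series with `∑ |f_α|² (2ℕ)^{-pα} < ∞`. -/
def hPrimeSubmodule (p : ℕ) : Submodule ℂ ChaosSeries where
  carrier := {f | Summable fun α => ‖f α‖ ^ 2 * (twoN α ^ p)⁻¹}
  zero_mem' := by simp
  add_mem' {f g} hf hg := by
    refine Summable.of_nonneg_of_le (fun α => ?_) (fun α => ?_)
      ((hf.mul_left 2).add (hg.mul_left 2))
    · have := twoN_pos α; positivity
    · have h0 := twoN_pos α
      have h1 : ‖f α + g α‖ ^ 2 ≤ 2 * ‖f α‖ ^ 2 + 2 * ‖g α‖ ^ 2 := by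
        have := norm_add_le (f α) (g α)
        nlinarith [sq_nonneg (‖f α‖ - ‖g α‖), norm_nonneg (f α + g α)]
      calc ‖(f + g) α‖ ^ 2 * (twoN α ^ p)⁻¹
          ≤ (2 * ‖f α‖ ^ 2 + 2 * ‖g α‖ ^ 2) * (twoN α ^ p)⁻¹ := by
            rw [Pi.add_apply]; gcongr
        _ = _ := by ring
  smul_mem' c f hf := by
    have := hf.mul_left (‖c‖ ^ 2)
    refine this.congr fun α => ?_
    simp only [Pi.smul_apply, smul_eq_mul, norm_mul]
    ring

/-- `𝓗_p'` as a type; its topology is the one of the norm below. -/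
def HPrime (p : ℕ) : Type := hPrimeSubmodule p

namespace HPrime

instance (p : ℕ) : AddCommGroup (HPrime p) := inferInstanceAs (AddCommGroup (hPrimeSubmodule p))

instance (p : ℕ) : Module ℂ (HPrime p) := inferInstanceAs (Module ℂ (hPrimeSubmodule p))

/-- The formal series underlying an element of `𝓗_p'`. -/
def series {p : ℕ} : HPrime p →ₗ[ℂ] ChaosSeries := (hPrimeSubmodule p).subtype

/-- The weight `(2ℕ)^{-pα/2}`. -/
def weight (p : ℕ) (α : ℕ →₀ ℕ) : ℝ := (Real.sqrt (twoN α ^ p))⁻¹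

theorem weight_pos (p : ℕ) (α : ℕ →₀ ℕ) : 0 < weight p α :=
  inv_pos.2 (Real.sqrt_pos.2 (pow_pos (twoN_pos α) p))

theorem norm_weight_mul (p : ℕ) (α : ℕ →₀ ℕ) (z : ℂ) :
    ‖(weight p α : ℂ) * z‖ ^ 2 = ‖z‖ ^ 2 * (twoN α ^ p)⁻¹ := by
  rw [norm_mul, mul_pow, Complex.norm_real, Real.norm_eq_abs, sq_abs, weight, inv_pow,
    Real.sq_sqrt (pow_pos (twoN_pos α) p).le, mul_comm]

/-- The map `(f_α) ↦ (f_α (2ℕ)^{-pα/2})` onto `ℓ²`. -/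
def toL2 (p : ℕ) : HPrime p ≃ₗ[ℂ] lp (fun _ : ℕ →₀ ℕ => ℂ) 2 where
  toFun f := ⟨fun α => (weight p α : ℂ) * series f α, by
    refine memℓp_gen ?_
    have h : Summable fun α => ‖series f α‖ ^ 2 * (twoN α ^ p)⁻¹ := f.2
    refine h.congr fun α => ?_
    rw [← norm_weight_mul]
    simp⟩
  map_add' f g := by
    refine Subtype.ext (funext fun α => ?_)
    change (weight p α : ℂ) * series (f + g) α = _
    rw [map_add, Pi.add_apply, mul_add]
    rfl
  map_smul' c f := by
    ext α
    simp only [map_smul, Pi.smul_apply, smul_eq_mul, RingHom.id_apply, lp.coeFn_smul]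
    ring
  invFun x := ⟨fun α => (weight p α : ℂ)⁻¹ * x α, by
    have h := (lp.memℓp x).summable (by simp)
    change Summable fun α => ‖(weight p α : ℂ)⁻¹ * x α‖ ^ 2 * (twoN α ^ p)⁻¹
    refine h.congr fun α => ?_
    rw [← norm_weight_mul, mul_inv_cancel_left₀ (by exact_mod_cast (weight_pos p α).ne')]
    simp⟩
  left_inv f := by
    refine Subtype.ext (funext fun α => ?_)
    exact inv_mul_cancel_left₀ (by exact_mod_cast (weight_pos p α).ne') _
  right_inv x := by
    ext α
    exact mul_inv_cancel_left₀ (by exact_mod_cast (weight_pos p α).ne') _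

instance (p : ℕ) : NormedAddCommGroup (HPrime p) :=
  NormedAddCommGroup.induced (HPrime p) (lp (fun _ : ℕ →₀ ℕ => ℂ) 2) (toL2 p) (toL2 p).injective

instance (p : ℕ) : NormedSpace ℂ (HPrime p) :=
  NormedSpace.induced ℂ (HPrime p) (lp (fun _ : ℕ →₀ ℕ => ℂ) 2) (toL2 p)

instance (p : ℕ) : CompleteSpace (HPrime p) := by
  have hi : Isometry (toL2 p) := AddMonoidHomClass.isometry_of_norm _ fun _ => rfl
  exact (IsometryEquiv.completeSpace ⟨(toL2 p).toEquiv, hi⟩)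

/-- The norm is `‖f‖² = ∑ |f_α|² (2ℕ)^{-pα}`. -/
theorem norm_sq {p : ℕ} (f : HPrime p) :
    ‖f‖ ^ 2 = ∑' α, ‖series f α‖ ^ 2 * (twoN α ^ p)⁻¹ := by
  have h := lp.norm_rpow_eq_tsum (p := 2) (by simp) (toL2 p f)
  change ‖toL2 p f‖ ^ 2 = _
  simp only [ENNReal.toReal_ofNat, Real.rpow_ofNat] at h
  rw [h]
  exact tsum_congr fun α => norm_weight_mul p α _

end HPrime

/-- The space `S₁` of stochastic test functions: `∑ (α!)² |g_α|² (2ℕ)^{kα} < ∞` for all `k`. -/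
def KondratievTest : Type :=
  {g : ChaosSeries // ∀ k : ℕ, Summable fun α => multiFactorial α ^ 2 * ‖g α‖ ^ 2 * twoN α ^ k}

/-- The bounded subsets of the countably normed space `S₁`: each of the norms is bounded. -/
def IsBoundedTest (B : Set KondratievTest) : Prop :=
  ∀ k : ℕ, ∃ C : ℝ, ∀ g ∈ B, ∑' α, multiFactorial α ^ 2 * ‖g.1 α‖ ^ 2 * twoN α ^ k ≤ C

/-- The space `S₋₁ = ⋃_p 𝓗_p'` of stochastic distributions. -/
def KondratievDist : Type := {f : ChaosSeries // ∃ p : ℕ, 1 ≤ p ∧ f ∈ hPrimeSubmodule p}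

/-- The duality `⟨f, g⟩ = ∑ α! f_α g_α` between `S₋₁` and `S₁`. -/
def kondratievPairing (f : KondratievDist) (g : KondratievTest) : ℂ :=
  ∑' α, (multiFactorial α : ℂ) * f.1 α * g.1 α

/-- The strong topology of `S₋₁`: uniform convergence on the bounded subsets of `S₁`. -/
instance : TopologicalSpace KondratievDist :=
  TopologicalSpace.induced
    (fun f => UniformOnFun.ofFun {B | IsBoundedTest B} (kondratievPairing f)) inferInstance

/-! ### The processes attached to a spectral measure -/

section Spectral

variable (σ : Measure ℝ) [IsFiniteMeasure σ]

/-- The exponential `e_t(u) = e^{itu}` as an element of `L²(dσ)`. -/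
def expL2 (t : ℝ) : Lp ℂ 2 σ :=
  (MemLp.of_bound (f := fun u : ℝ => Complex.exp (Complex.I * (t : ℂ) * (u : ℂ)))
    (by fun_prop) 1 (Eventually.of_forall fun u => by
      rw [show Complex.I * (t : ℂ) * (u : ℂ) = ((t * u : ℝ) : ℂ) * Complex.I by push_cast; ring,
        Complex.norm_exp_ofReal_mul_I])).toLp

/-- `(σ, {λ_0, λ_1, …})` is a spectral pair: the `e_{λ_n}` form an orthonormal basis of
`L²(dσ)`. -/
structure IsSpectralPair (lam : ℕ → ℝ) : Prop where
  orthonormal : Orthonormal ℂ fun n => expL2 σ (lam n)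
  complete : (Submodule.span ℂ (Set.range fun n => expL2 σ (lam n))).topologicalClosure = ⊤

/-- The unitary map `L²(dσ) → L²(ℝ, dx)` with `e_{λ_n} ↦ h_n`. -/
def spectralMap (lam : ℕ → ℝ) (φ : Lp ℂ 2 σ) : Lp ℂ 2 (volume : Measure ℝ) :=
  ∑' n, inner ℂ (expL2 σ (lam n)) φ • hermiteL2 n

/-- The Fourier transform `f̂(u) = ∫ e^{iux} f(x) dx`. -/
def fourierHat (f : ℝ → ℂ) (u : ℝ) : ℂ :=
  ∫ x : ℝ, Complex.exp (Complex.I * (u : ℂ) * (x : ℂ)) * f x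

theorem norm_exp_I_mul (u x : ℝ) :
    ‖Complex.exp (Complex.I * (u : ℂ) * (x : ℂ))‖ = 1 := by
  rw [show Complex.I * (u : ℂ) * (x : ℂ) = ((u * x : ℝ) : ℂ) * Complex.I by push_cast; ring,
    Complex.norm_exp_ofReal_mul_I]

theorem memLp_fourierHat {f : ℝ → ℂ} (hf : Integrable f) : MemLp (fourierHat f) 2 σ := by
  have hc : Continuous (fourierHat f) := by
    refine continuous_of_dominated (bound := fun x => ‖f x‖) (fun u => ?_) (fun u => ?_)
      hf.norm ?_
    · exact (Continuous.aestronglyMeasurable (by fun_prop)).mul hf.1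
    · exact Eventually.of_forall fun x => by rw [norm_mul, norm_exp_I_mul, one_mul]
    · exact Eventually.of_forall fun x => by fun_prop
  refine MemLp.of_bound hc.aestronglyMeasurable (∫ x, ‖f x‖) (Eventually.of_forall fun u => ?_)
  refine (norm_integral_le_integral_norm _).trans (le_of_eq ?_)
  simp only [norm_mul, norm_exp_I_mul, one_mul]

/-- The operator `Q_σ`: `f ↦ f̂(T) h₀`, where `T` is the operator on `L²(ℝ, dx)` which the unitary
map `spectralMap` makes out of multiplication by `u` in `L²(dσ)`. For `λ_0 = 0` one has
`e_{λ_0} = 1`, so that `f̂(T) h₀` is the image of `f̂ · 1` under that map. -/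
def Qop (lam : ℕ → ℝ) {f : ℝ → ℂ} (hf : Integrable f) : Lp ℂ 2 (volume : Measure ℝ) :=
  spectralMap σ lam (memLp_fourierHat σ hf).toLp

/-- `1_{[0,t]}`, with the usual convention `1_{[0,t]} = -1_{[t,0]}` for `t < 0`. -/
def indicatorZero (t : ℝ) (x : ℝ) : ℂ :=
  (Set.Ioc 0 t).indicator 1 x - (Set.Ioc t 0).indicator 1 x

theorem integrable_indicatorZero (t : ℝ) : Integrable (indicatorZero t) := by
  refine Integrable.sub ?_ ?_
  · exact (integrable_indicator_iff measurableSet_Ioc).2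
      (integrableOn_const (hs := by simp))
  · exact (integrable_indicator_iff measurableSet_Ioc).2
      (integrableOn_const (hs := by simp))

variable (lam : ℕ → ℝ) (P : Measure TemperedDual) [IsWhiteNoise P]

/-- The stationary increment process `X_σ(t) = (Q_σ 1_{[0,t]})~` in the white noise space. -/
def processX (t : ℝ) : Lp ℂ 2 P :=
  tildeC P (Qop σ lam (integrable_indicatorZero t))

/-- `W_σ(t)`, the derivative of `X_σ` in the norm of the white noise space. -/
def processW (t : ℝ) : Lp ℂ 2 P := deriv (processX σ lam P) t

end Spectral

end KondratievIto

end

noncomputable section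

namespace KondratievIto

/-! ### Orthogonality of the Hermite polynomials and functions -/

/-! The limit is a Riemann–Stieltjes limit for a continuous bilinear map between Hilbert spaces,
once everything has been moved into a single `𝓗_p'`. Three facts make this possible.

The integrand: a strongly continuous family on a compact set has coefficients bounded by one `C
(2ℕ)^{qα}` (`exists_norm_coeff_le_of_isCompact`). Since `∑ (2ℕ)^{-2α} < ∞`, it then lies in one
`𝓗_p'` with `p ≥ 2`, and dominated convergence makes it norm continuous there
(`exists_continuousOn_hPrime`).

The integrator: `X_σ(t)` is a fixed bounded real-linear map applied to the transform of `1_{[0,t]}`,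
whose derivative in `L²(dσ)` is `e_t`. Hence `X_σ` is `C¹` in `L²(P)`. By Cauchy–Schwarz and
`E[H_α²] = α!` the chaos coefficients of `F` are at most `‖F‖`, so `L²(P)` maps continuously into
`𝓗_p'` for `p ≥ 2`, and `X_σ` stays `C¹` there.

The product: `γ` has at most `(2ℕ)^γ` decompositions `α + β`, so the Wick product is bounded from
`𝓗_p' × 𝓗_p'` to `𝓗_{p+1}'`. Uniform continuity of `Y` on `[a,b]` and boundedness of `W_σ` there
give the limit (`exists_norm_sum_sub_integral_lt`). -/

theorem integrable_polyGaussian (p : Polynomial ℝ) :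
    Integrable fun x : ℝ => p.eval x * Real.exp (-(x ^ 2 / 2)) :=
  (polyGaussian p).integrable

theorem integral_X_mul_polyGaussian (p : Polynomial ℝ) :
    ∫ x : ℝ, (Polynomial.X * p).eval x * Real.exp (-(x ^ 2 / 2)) =
      ∫ x : ℝ, (Polynomial.derivative p).eval x * Real.exp (-(x ^ 2 / 2)) := by
  have hd : ∀ x : ℝ, HasDerivAt (fun x : ℝ => p.eval x * Real.exp (-(x ^ 2 / 2)))
      ((Polynomial.derivative p - Polynomial.X * p).eval x * Real.exp (-(x ^ 2 / 2))) x := by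
    intro x
    have h0 : HasDerivAt (fun x : ℝ => -(x ^ 2 / 2)) (-x) x := by
      refine ((hasDerivAt_pow 2 x).div_const 2).neg.congr_deriv ?_
      norm_num
    refine ((p.hasDerivAt x).mul h0.exp).congr_deriv ?_
    simp only [Polynomial.eval_sub, Polynomial.eval_mul, Polynomial.eval_X]
    ring
  have h := integral_eq_zero_of_hasDerivAt_of_integrable hd (integrable_polyGaussian _)
    (integrable_polyGaussian p)
  simp only [Polynomial.eval_sub, sub_mul] at h
  rw [integral_sub (integrable_polyGaussian _) (integrable_polyGaussian _), sub_eq_zero] at h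
  exact h.symm

/-- The probabilists' Hermite polynomial with real coefficients. -/
def realHermite (n : ℕ) : Polynomial ℝ := (Polynomial.hermite n).map (Int.castRingHom ℝ)

theorem aeval_hermite (n : ℕ) (x : ℝ) :
    Polynomial.aeval x (Polynomial.hermite n) = (realHermite n).eval x := by
  simp [realHermite, Polynomial.eval_map, Polynomial.aeval_def]

theorem realHermite_succ (n : ℕ) : realHermite (n + 1) =
    Polynomial.X * realHermite n - Polynomial.derivative (realHermite n) := by
  simp [realHermite, Polynomial.hermite_succ, Polynomial.derivative_map]

theorem natDegree_realHermite (n : ℕ) : (realHermite n).natDegree = n := by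
  rw [realHermite, (Polynomial.hermite_monic n).natDegree_map, Polynomial.natDegree_hermite]

theorem coeff_realHermite_self (n : ℕ) : (realHermite n).coeff n = 1 := by
  simp [realHermite, Polynomial.coeff_hermite_self]

/-- Integration by parts: in `He_{n+1} = X He_n - He_n'` the factor `X` becomes a derivative under
the Gaussian weight, and what survives falls on `q`. Taking `q = He_m` with `m < n` gives
orthogonality; `m = n` gives the norm, as `He_n` is monic. -/
theorem integral_realHermite_mul (n : ℕ) (q : Polynomial ℝ) :
    ∫ x : ℝ, (realHermite n * q).eval x * Real.exp (-(x ^ 2 / 2)) =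
      ∫ x : ℝ, (Polynomial.derivative^[n] q).eval x * Real.exp (-(x ^ 2 / 2)) := by
  induction n generalizing q with
  | zero => simp [realHermite]
  | succ n ih =>
    rw [Function.iterate_succ_apply, ← ih]
    have h1 : realHermite (n + 1) * q = Polynomial.X * (realHermite n * q) -
        Polynomial.derivative (realHermite n) * q := by
      rw [realHermite_succ]; ring
    have h2 : realHermite n * Polynomial.derivative q =
        Polynomial.derivative (realHermite n * q) - Polynomial.derivative (realHermite n) * q := by
      rw [Polynomial.derivative_mul]; ring
    rw [h1, h2]
    simp only [Polynomial.eval_sub, sub_mul]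
    rw [integral_sub (integrable_polyGaussian _) (integrable_polyGaussian _),
      integral_sub (integrable_polyGaussian _) (integrable_polyGaussian _),
      integral_X_mul_polyGaussian]

theorem integral_realHermite_mul_of_lt {m n : ℕ} (h : m < n) :
    ∫ x : ℝ, (realHermite n * realHermite m).eval x * Real.exp (-(x ^ 2 / 2)) = 0 := by
  rw [integral_realHermite_mul, Polynomial.iterate_derivative_eq_zero
    (by rwa [natDegree_realHermite])]
  simp

theorem integral_realHermite_mul_self (n : ℕ) :
    ∫ x : ℝ, (realHermite n * realHermite n).eval x * Real.exp (-(x ^ 2 / 2)) =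
      n.factorial * Real.sqrt (2 * Real.pi) := by
  have h1 : Polynomial.derivative^[n] (realHermite n) = Polynomial.C (n.factorial : ℝ) := by
    rw [Polynomial.eq_C_of_natDegree_le_zero
      ((Polynomial.natDegree_iterate_derivative _ _).trans (by rw [natDegree_realHermite]; simp)),
      Polynomial.coeff_iterate_derivative]
    simp [coeff_realHermite_self, Nat.descFactorial_self]
  rw [integral_realHermite_mul, h1]
  simp only [Polynomial.eval_C]
  rw [integral_const_mul]
  have h2 := integral_gaussian (1 / 2)
  have h3 : ∀ x : ℝ, -(x ^ 2 / 2) = -(1 / 2) * x ^ 2 := fun x => by ring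
  simp only [h3, h2]
  congr 2
  field_simp

theorem hermiteFun_mul_eq (m n : ℕ) (x : ℝ) : hermiteFun m x * hermiteFun n x =
    (Real.sqrt (Real.sqrt Real.pi * m.factorial))⁻¹ *
      (Real.sqrt (Real.sqrt Real.pi * n.factorial))⁻¹ *
      (fun y : ℝ => (realHermite m * realHermite n).eval y * Real.exp (-(y ^ 2 / 2)))
        (Real.sqrt 2 * x) := by
  rw [hermiteFun_apply, hermiteFun_apply, aeval_hermite, aeval_hermite]
  have h : Real.exp (-((Real.sqrt 2 * x) ^ 2 / 2)) =
      Real.exp (-(x ^ 2 / 2)) * Real.exp (-(x ^ 2 / 2)) := by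
    rw [← Real.exp_add, mul_pow, Real.sq_sqrt (by norm_num)]
    congr 1
    ring
  simp only [Polynomial.eval_mul, h]
  ring

theorem integral_hermiteFun_mul (m n : ℕ) :
    ∫ x : ℝ, hermiteFun m x * hermiteFun n x = if m = n then 1 else 0 := by
  simp only [hermiteFun_mul_eq]
  rw [integral_const_mul, Measure.integral_comp_mul_left
    (fun y : ℝ => (realHermite m * realHermite n).eval y * Real.exp (-(y ^ 2 / 2))) (Real.sqrt 2)]
  split_ifs with h
  · subst h
    -- The Jacobian `1/√2` of the substitution `y = √2 x` turns `√(2π)` into the `√π` of the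
    -- normalisation.
    rw [integral_realHermite_mul_self, abs_of_pos (by positivity), smul_eq_mul, ← mul_inv,
      Real.mul_self_sqrt (by positivity), Real.sqrt_mul (by norm_num)]
    have := Real.pi_pos
    field_simp
  · have h0 : ∫ x : ℝ, (realHermite m * realHermite n).eval x * Real.exp (-(x ^ 2 / 2)) = 0 := by
      rcases lt_or_gt_of_ne h with h | h
      · rw [mul_comm, integral_realHermite_mul_of_lt h]
      · exact integral_realHermite_mul_of_lt h
    rw [h0]
    simp

theorem orthonormal_hermiteL2 : Orthonormal ℂ hermiteL2 := by
  rw [orthonormal_iff_ite]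
  intro m n
  have hae : ∀ k : ℕ, hermiteL2 k =ᵐ[volume] fun x => (hermiteFun k x : ℂ) := fun k => by
    refine (ContinuousLinearMap.coeFn_compLpL _ _).trans ?_
    filter_upwards [(hermiteFun k).coeFn_toLp 2 volume] with x hx
    rw [hx]
    rfl
  rw [L2.inner_def]
  have h : ∫ x : ℝ, inner ℂ (hermiteL2 m x) (hermiteL2 n x) =
      ∫ x : ℝ, ((hermiteFun m x * hermiteFun n x : ℝ) : ℂ) := by
    refine integral_congr_ae ?_
    filter_upwards [hae m, hae n] with x hm hn
    rw [hm, hn]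
    simp [mul_comm]
  rw [h, integral_complex_ofReal, integral_hermiteFun_mul]
  split_ifs <;> simp


/-! ### The second moments of `H_α` and the chaos coefficients -/

theorem integral_sq_sum_hermiteFun {ι : Type*} [Fintype ι] {k : ι → ℕ}
    (hk : Function.Injective k) (t : ι → ℝ) :
    ∫ x : ℝ, ((∑ i, t i • hermiteFun (k i)) x) ^ 2 = ∑ i, t i ^ 2 := by
  classical
  have hint : ∀ m n : ℕ, Integrable fun x : ℝ => hermiteFun m x * hermiteFun n x := fun m n => by
    simp only [hermiteFun_mul_eq]
    exact ((integrable_polyGaussian _).comp_mul_left' (by positivity)).const_mul _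
  have h : ∀ x : ℝ, ((∑ i, t i • hermiteFun (k i)) x) ^ 2 =
      ∑ i, ∑ j, t i * t j * (hermiteFun (k i) x * hermiteFun (k j) x) := fun x => by
    rw [sum_apply, sq, Finset.sum_mul_sum]
    refine Finset.sum_congr rfl fun i _ => Finset.sum_congr rfl fun j _ => ?_
    simp only [smul_apply, smul_eq_mul]
    ring
  simp only [h]
  rw [integral_finsetSum _ fun i _ => integrable_finsetSum _ fun j _ => (hint _ _).const_mul _]
  refine Finset.sum_congr rfl fun i _ => ?_
  rw [integral_finsetSum _ fun j _ => (hint _ _).const_mul _, Finset.sum_eq_single i]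
  · rw [integral_const_mul, integral_hermiteFun_mul]
    simp [sq]
  · intro j _ hj
    rw [integral_const_mul, integral_hermiteFun_mul, if_neg (fun h => hj (hk h).symm), mul_zero]
  · simp

section WhiteNoise

variable (P : Measure TemperedDual) [IsWhiteNoise P]

theorem map_eval_hermiteFun (k : ℕ) :
    P.map (fun w : TemperedDual => w (hermiteFun k)) = gaussianReal 0 1 := by
  rw [map_eval_eq_gaussian]
  congr 1
  have h : ∫ x : ℝ, hermiteFun k x ^ 2 = 1 := by
    simp only [sq]
    rw [integral_hermiteFun_mul, if_pos rfl]
  rw [h, Real.toNNReal_one]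

/-- The characteristic functional at `∑ t_i h_{k_i}` depends only on the `L²` norm, which is `∑
t_i²` by orthonormality, so the joint characteristic function is the product of the standard
Gaussian ones. -/
theorem iIndepFun_eval_hermiteFun {ι : Type*} [Fintype ι] {k : ι → ℕ}
    (hk : Function.Injective k) :
    iIndepFun (fun (i : ι) (w : TemperedDual) => w (hermiteFun (k i))) P := by
  have hm : ∀ i, AEMeasurable (fun w : TemperedDual => w (hermiteFun (k i))) P :=
    fun i => (measurable_eval _).aemeasurable
  have hm' : AEMeasurable
      (fun w : TemperedDual => WithLp.toLp 2 fun i => w (hermiteFun (k i))) P :=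
    (WithLp.measurable_toLp 2 _).comp_aemeasurable (aemeasurable_pi_lambda _ hm)
  rw [iIndepFun_iff_charFun_pi hm]
  intro t
  simp only [map_eval_hermiteFun, charFun_gaussianReal]
  rw [charFun_apply, integral_map hm' (by fun_prop)]
  -- The minus sign compensates for `e^{-i⟨ω,s⟩}` in the characteristic functional.
  have h := IsWhiteNoise.charFunctional (P := P) (-∑ i, t i • hermiteFun (k i))
  have h1 : ∫ x : ℝ, ((-∑ i, t i • hermiteFun (k i)) x) ^ 2 = ∑ i, t i ^ 2 := by
    rw [← integral_sq_sum_hermiteFun hk]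
    refine integral_congr_ae (Eventually.of_forall fun x => ?_)
    simp only [neg_apply, neg_sq]
  rw [h1] at h
  rw [← Complex.exp_sum]
  refine Eq.trans ?_ (h.trans ?_)
  · refine integral_congr_ae (Eventually.of_forall fun w => ?_)
    simp only [PiLp.inner_apply, map_neg, map_sum, map_smul]
    congr 1
    simp [mul_comm]
  · congr 1
    push_cast
    simp [Finset.sum_div, neg_div, Finset.sum_neg_distrib]

theorem lintegral_sq_hermite_gaussian (n : ℕ) :
    ∫⁻ x, ENNReal.ofReal ((realHermite n).eval x ^ 2) ∂(gaussianReal 0 1) = n.factorial := by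
  have hm : Measurable fun x : ℝ => (realHermite n).eval x := (realHermite n).continuous.measurable
  rw [gaussianReal_of_var_ne_zero _ one_ne_zero,
    lintegral_withDensity_eq_lintegral_mul _ (measurable_gaussianPDF 0 1) (by fun_prop)]
  have h : ∀ x : ℝ, (gaussianPDF 0 1 * fun x => ENNReal.ofReal ((realHermite n).eval x ^ 2)) x =
      ENNReal.ofReal ((Real.sqrt (2 * Real.pi))⁻¹ *
        ((realHermite n * realHermite n).eval x * Real.exp (-(x ^ 2 / 2)))) := fun x => by
    rw [Pi.mul_apply, gaussianPDF, ← ENNReal.ofReal_mul (gaussianPDFReal_nonneg 0 1 x)]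
    congr 1
    simp only [gaussianPDFReal, Polynomial.eval_mul, NNReal.coe_one, sub_zero, mul_one, neg_div]
    ring
  simp only [h]
  rw [← ofReal_integral_eq_lintegral_ofReal ((integrable_polyGaussian _).const_mul _)
    (Eventually.of_forall fun x => ?_), integral_const_mul, integral_realHermite_mul_self]
  · rw [mul_comm (n.factorial : ℝ), inv_mul_cancel_left₀ (by positivity), ENNReal.ofReal_natCast]
  · simp only [Polynomial.eval_mul]
    exact mul_nonneg (by positivity) (mul_nonneg (mul_self_nonneg _) (Real.exp_pos _).le)

theorem measurable_hermiteChaos (α : ℕ →₀ ℕ) : Measurable (hermiteChaos α) := by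
  unfold hermiteChaos Finsupp.prod
  refine Finset.measurable_fun_prod _ fun k _ => ?_
  simp only [aeval_hermite]
  exact (realHermite (α k)).continuous.measurable.comp (measurable_eval _)

theorem multiFactorial_pos (α : ℕ →₀ ℕ) : 0 < multiFactorial α :=
  Finset.prod_pos fun _ _ => by positivity

theorem one_le_multiFactorial (α : ℕ →₀ ℕ) : 1 ≤ multiFactorial α :=
  Finset.one_le_prod fun k _ => Nat.one_le_cast.2 (Nat.succ_le_of_lt (α k).factorial_pos)

/-- Independence factors the second moment into the one-dimensional ones. With the lower integral no
prior integrability is required; square integrability of `H_α` is a consequence. -/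
theorem lintegral_sq_hermiteChaos (α : ℕ →₀ ℕ) :
    ∫⁻ w, ENNReal.ofReal (hermiteChaos α w ^ 2) ∂P = ENNReal.ofReal (multiFactorial α) := by
  have hind := iIndepFun_eval_hermiteFun P (k := fun i : α.support => (i : ℕ))
    Subtype.val_injective
  have hm : ∀ i : α.support,
      Measurable fun x : ℝ => ENNReal.ofReal ((realHermite (α i)).eval x ^ 2) := fun i => by
    have : Measurable fun x : ℝ => (realHermite (α i)).eval x :=
      (realHermite (α i)).continuous.measurable
    fun_prop
  have h := lintegral_prod_eq_prod_lintegral_of_indepFun Finset.univ _ (hind.comp _ hm)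
    fun i => (hm i).comp (measurable_eval (hermiteFun i))
  have h1 : ∀ w : TemperedDual, ENNReal.ofReal (hermiteChaos α w ^ 2) =
      ∏ i : α.support, ENNReal.ofReal ((realHermite (α i)).eval (w (hermiteFun i)) ^ 2) := by
    intro w
    rw [← ENNReal.ofReal_prod_of_nonneg fun i _ => sq_nonneg _, Finset.prod_pow, hermiteChaos,
      Finsupp.prod, ← Finset.prod_coe_sort]
    simp only [aeval_hermite]
  simp only [h1]
  refine h.trans ?_
  rw [multiFactorial, Finsupp.prod,
    ← Finset.prod_coe_sort α.support fun i => ((α i).factorial : ℝ),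
    ENNReal.ofReal_prod_of_nonneg fun i _ => Nat.cast_nonneg _]
  refine Finset.prod_congr rfl fun i _ => ?_
  rw [ENNReal.ofReal_natCast, ← lintegral_sq_hermite_gaussian, ← map_eval_hermiteFun P i,
    lintegral_map (hm i) (measurable_eval _)]
  rfl

theorem eLpNorm_hermiteChaos (α : ℕ →₀ ℕ) :
    eLpNorm (fun w => (hermiteChaos α w : ℂ)) 2 P =
      ENNReal.ofReal (Real.sqrt (multiFactorial α)) := by
  rw [eLpNorm_eq_lintegral_rpow_enorm_toReal (by simp) (by simp), Real.sqrt_eq_rpow,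
    ← ENNReal.ofReal_rpow_of_nonneg (multiFactorial_pos α).le (by simp),
    ← lintegral_sq_hermiteChaos P]
  simp only [ENNReal.toReal_ofNat]
  congr 1
  refine lintegral_congr fun w => ?_
  rw [← ofReal_norm, ENNReal.ofReal_rpow_of_nonneg (norm_nonneg _) (by simp)]
  simp

theorem memLp_hermiteChaos (α : ℕ →₀ ℕ) : MemLp (fun w => (hermiteChaos α w : ℂ)) 2 P :=
  ⟨(Complex.measurable_ofReal.comp (measurable_hermiteChaos α)).aestronglyMeasurable, by
    rw [eLpNorm_hermiteChaos]; exact ENNReal.ofReal_lt_top⟩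

theorem integral_mul_hermiteChaos_eq_inner (F : Lp ℂ 2 P) (α : ℕ →₀ ℕ) :
    ∫ w, F w * (hermiteChaos α w : ℂ) ∂P = inner ℂ (memLp_hermiteChaos P α).toLp F := by
  rw [L2.inner_def]
  refine integral_congr_ae ?_
  filter_upwards [(memLp_hermiteChaos P α).coeFn_toLp] with w hw
  rw [hw]
  simp

/-- Cauchy–Schwarz, with `‖H_α‖ = √α! ≤ α!`. The estimate is crude, but bounded coefficients suffice
for `𝓗_p'` with `p ≥ 2`. -/
theorem norm_chaosCoeff_le (F : Lp ℂ 2 P) (α : ℕ →₀ ℕ) : ‖chaosCoeff P F α‖ ≤ ‖F‖ := by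
  have h1 := norm_inner_le_norm (𝕜 := ℂ) (memLp_hermiteChaos P α).toLp F
  rw [Lp.norm_toLp, eLpNorm_hermiteChaos, ENNReal.toReal_ofReal (Real.sqrt_nonneg _)] at h1
  have h2 : Real.sqrt (multiFactorial α) ≤ multiFactorial α := by
    rw [Real.sqrt_le_left (multiFactorial_pos α).le]
    nlinarith [one_le_multiFactorial α]
  rw [chaosCoeff, integral_mul_hermiteChaos_eq_inner, norm_div, Complex.norm_real,
    Real.norm_of_nonneg (multiFactorial_pos α).le, div_le_iff₀ (multiFactorial_pos α), mul_comm]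
  exact h1.trans (mul_le_mul_of_nonneg_right h2 (norm_nonneg F))

theorem chaosCoeff_add (F G : Lp ℂ 2 P) :
    chaosCoeff P (F + G) = chaosCoeff P F + chaosCoeff P G := by
  funext α
  simp only [Pi.add_apply, chaosCoeff, integral_mul_hermiteChaos_eq_inner, inner_add_right, add_div]

theorem chaosCoeff_smul (c : ℂ) (F : Lp ℂ 2 P) : chaosCoeff P (c • F) = c • chaosCoeff P F := by
  funext α
  simp only [Pi.smul_apply, smul_eq_mul, chaosCoeff, integral_mul_hermiteChaos_eq_inner,
    inner_smul_right, mul_div_assoc]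

end WhiteNoise


/-! ### The weights `(2ℕ)^α` -/

theorem one_le_twoN (α : ℕ →₀ ℕ) : 1 ≤ twoN α :=
  Finset.one_le_prod fun k _ => one_le_pow₀ (by
    have : (0 : ℝ) ≤ k := k.cast_nonneg
    linarith)

theorem twoN_add (α β : ℕ →₀ ℕ) : twoN (α + β) = twoN α * twoN β :=
  Finsupp.prod_add_index' (fun _ => pow_zero _) fun _ _ _ => pow_add _ _ _

theorem twoN_eq_mul_erase (α : ℕ →₀ ℕ) (k : ℕ) :
    twoN α = (2 * ((k : ℝ) + 1)) ^ α k * twoN (α.erase k) :=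
  (Finsupp.mul_prod_erase' α k (fun k m => (2 * ((k : ℝ) + 1)) ^ m) fun _ => pow_zero _).symm

/-- There are `∏ (γ_k + 1)` decompositions, and `m + 1 ≤ 2^m ≤ (2(k+1))^m`. -/
theorem card_antidiagonal_le_twoN (γ : ℕ →₀ ℕ) :
    ((Finset.HasAntidiagonal.antidiagonal γ).card : ℝ) ≤ twoN γ := by
  have h1 : (Finset.HasAntidiagonal.antidiagonal γ).card ≤ (Finset.Iic γ).card := by
    refine Finset.card_le_card_of_injOn Prod.fst (fun q hq => ?_) fun q hq r hr h => ?_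
    · have := Finset.HasAntidiagonal.mem_antidiagonal.1 hq
      exact Finset.mem_coe.2 (Finset.mem_Iic.2 (this ▸ le_self_add))
    · have hq := Finset.HasAntidiagonal.mem_antidiagonal.1 hq
      have hr := Finset.HasAntidiagonal.mem_antidiagonal.1 hr
      refine Prod.ext h (add_left_cancel (a := q.1) ?_)
      rw [hq, h, hr]
  refine (Nat.cast_le.2 h1).trans ?_
  rw [Finsupp.card_Iic, Nat.cast_prod, twoN, Finsupp.prod]
  refine Finset.prod_le_prod (fun _ _ => Nat.cast_nonneg _) fun k _ => ?_
  have h2 : γ k + 1 ≤ 2 ^ γ k := Nat.lt_two_pow_self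
  have h3 : (2 : ℝ) ≤ 2 * ((k : ℝ) + 1) := by
    have : (0 : ℝ) ≤ k := k.cast_nonneg
    linarith
  calc (((Finset.Iic (γ k)).card : ℕ) : ℝ) = ((γ k + 1 : ℕ) : ℝ) := by rw [Nat.card_Iic]
    _ ≤ ((2 ^ γ k : ℕ) : ℝ) := Nat.cast_le.2 h2
    _ = (2 : ℝ) ^ γ k := by push_cast; rfl
    _ ≤ _ := by gcongr

/-- The sum over multi-indices in the first `N` variables is bounded by `∏_{k<N} (1 -
(2(k+1))^{-2})⁻¹`, a partial Wallis product. The bound `2 - 1/(N+1)` is chosen to close the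
induction; it stays below `2` for every `N`. -/
theorem sum_inv_twoN_sq_le (N : ℕ) (s : Finset (ℕ →₀ ℕ)) (hs : ∀ α ∈ s, ∀ k, N ≤ k → α k = 0) :
    ∑ α ∈ s, (twoN α ^ 2)⁻¹ ≤ (2 * N + 1) / (N + 1) := by
  classical
  induction N generalizing s with
  | zero =>
    have h : s ⊆ {0} := fun α hα => by
      rw [Finset.mem_singleton]
      exact Finsupp.ext fun k => hs α hα k k.zero_le
    refine (Finset.sum_le_sum_of_subset_of_nonneg h fun α _ _ => ?_).trans ?_
    · have := twoN_pos α
      positivity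
    · simp [twoN]
  | succ N ih =>
    set r : ℝ := ((2 * ((N : ℝ) + 1)) ^ 2)⁻¹ with hr
    have hN : (0 : ℝ) ≤ N := N.cast_nonneg
    have hr0 : 0 ≤ r := by positivity
    have hr1 : r < 1 := by
      rw [hr]
      refine inv_lt_one_of_one_lt₀ ?_
      nlinarith
    have h1 : ∀ α, (twoN α ^ 2)⁻¹ = r ^ α N * (twoN (α.erase N) ^ 2)⁻¹ := fun α => by
      rw [twoN_eq_mul_erase α N, mul_pow, mul_inv, hr, inv_pow, ← pow_mul, ← pow_mul,
        mul_comm (α N)]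
    -- Splitting off the entry at `N` embeds `s` in a product: a geometric series in `r` times a sum
    -- over the first `N` variables.
    have hinj : Set.InjOn (fun α : ℕ →₀ ℕ => (α N, α.erase N)) s := by
      intro α _ β _ h
      rw [Prod.mk.injEq] at h
      rw [← Finsupp.single_add_erase N α, ← Finsupp.single_add_erase N β, h.1, h.2]
    have h2 : ∑ α ∈ s, (twoN α ^ 2)⁻¹ =
        ∑ q ∈ s.image (fun α => (α N, α.erase N)), r ^ q.1 * (twoN q.2 ^ 2)⁻¹ := by
      rw [Finset.sum_image hinj]
      exact Finset.sum_congr rfl fun α _ => h1 α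
    have h3 : s.image (fun α => (α N, α.erase N)) ⊆
        (s.image fun α => α N) ×ˢ (s.image fun α => α.erase N) := by
      intro q hq
      obtain ⟨α, hα, rfl⟩ := Finset.mem_image.1 hq
      exact Finset.mem_product.2 ⟨Finset.mem_image_of_mem _ hα, Finset.mem_image_of_mem _ hα⟩
    have h4 : ∑ m ∈ s.image (fun α => α N), r ^ m ≤ (1 - r)⁻¹ := by
      rw [← tsum_geometric_of_lt_one hr0 hr1]
      exact (summable_geometric_of_lt_one hr0 hr1).sum_le_tsum _ fun m _ => pow_nonneg hr0 m
    have h5 := ih (s.image fun α => α.erase N) fun β hβ k hk => by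
      obtain ⟨α, hα, rfl⟩ := Finset.mem_image.1 hβ
      rcases hk.eq_or_lt with rfl | hk
      · exact Finsupp.erase_same
      · rw [Finsupp.erase_ne hk.ne']
        exact hs α hα k hk
    calc ∑ α ∈ s, (twoN α ^ 2)⁻¹
        ≤ ∑ q ∈ (s.image fun α => α N) ×ˢ (s.image fun α => α.erase N),
            r ^ q.1 * (twoN q.2 ^ 2)⁻¹ := by
          rw [h2]
          refine Finset.sum_le_sum_of_subset_of_nonneg h3 fun q _ _ => ?_
          have := twoN_pos q.2
          positivity
      _ = (∑ m ∈ s.image (fun α => α N), r ^ m) *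
            ∑ β ∈ s.image (fun α => α.erase N), (twoN β ^ 2)⁻¹ := by
          rw [Finset.sum_product, Finset.sum_mul_sum]
      _ ≤ (1 - r)⁻¹ * ((2 * N + 1) / (N + 1)) := by
          refine mul_le_mul h4 h5 (Finset.sum_nonneg fun β _ => ?_) (by
            rw [inv_nonneg]; linarith)
          have := twoN_pos β
          positivity
      _ ≤ (2 * ((N + 1 : ℕ) : ℝ) + 1) / ((N + 1 : ℕ) + 1) := by
          have h6 : 1 - r = (2 * N + 1) * (2 * N + 3) / (2 * (N + 1)) ^ 2 := by
            rw [hr]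
            field_simp
            ring
          rw [h6, inv_div]
          push_cast
          rw [div_mul_div_comm, div_le_div_iff₀ (by positivity) (by positivity)]
          have : 0 ≤ (2 * (N : ℝ) + 1) * (N + 1) := by positivity
          nlinarith [mul_nonneg this hN]

theorem summable_inv_twoN_sq : Summable fun α : ℕ →₀ ℕ => (twoN α ^ 2)⁻¹ := by
  classical
  refine summable_of_sum_le (c := 2) (fun α => ?_) fun s => ?_
  · have := twoN_pos α
    positivity
  · obtain ⟨N, hN⟩ := (s.biUnion Finsupp.support).bddAbove
    refine (sum_inv_twoN_sq_le (N + 1) s fun α hα k hk => ?_).trans ?_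
    · by_contra h
      have := hN (Finset.mem_coe.2 (Finset.mem_biUnion.2 ⟨α, hα, Finsupp.mem_support_iff.2 h⟩))
      omega
    · push_cast
      rw [div_le_iff₀ (by positivity)]
      linarith

/-! ### The Wick product as a bounded bilinear map -/

/-- Cauchy–Schwarz over the decompositions of `γ` costs their number, at most `(2ℕ)^γ`. The extra
power of the weight absorbs it, and the remaining weight is multiplicative. -/
theorem norm_wick_sq_mul_le (p : ℕ) (f g : ChaosSeries) (γ : ℕ →₀ ℕ) :
    ‖wick f g γ‖ ^ 2 * (twoN γ ^ (p + 1))⁻¹ ≤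
      ∑ q ∈ Finset.HasAntidiagonal.antidiagonal γ,
        (‖f q.1‖ ^ 2 * (twoN q.1 ^ p)⁻¹) * (‖g q.2‖ ^ 2 * (twoN q.2 ^ p)⁻¹) := by
  have h0 := twoN_pos γ
  have h1 : ‖wick f g γ‖ ^ 2 ≤ twoN γ *
      ∑ q ∈ Finset.HasAntidiagonal.antidiagonal γ, (‖f q.1‖ * ‖g q.2‖) ^ 2 := by
    calc ‖wick f g γ‖ ^ 2
        ≤ (∑ q ∈ Finset.HasAntidiagonal.antidiagonal γ, ‖f q.1‖ * ‖g q.2‖) ^ 2 := by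
          refine pow_le_pow_left₀ (norm_nonneg _) ?_ 2
          exact (norm_sum_le _ _).trans_eq (Finset.sum_congr rfl fun q _ => norm_mul _ _)
      _ ≤ (Finset.HasAntidiagonal.antidiagonal γ).card *
          ∑ q ∈ Finset.HasAntidiagonal.antidiagonal γ, (‖f q.1‖ * ‖g q.2‖) ^ 2 :=
          sq_sum_le_card_mul_sum_sq
      _ ≤ _ := by
          gcongr
          exact card_antidiagonal_le_twoN γ
  calc ‖wick f g γ‖ ^ 2 * (twoN γ ^ (p + 1))⁻¹
      ≤ (twoN γ * ∑ q ∈ Finset.HasAntidiagonal.antidiagonal γ, (‖f q.1‖ * ‖g q.2‖) ^ 2) *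
          (twoN γ ^ (p + 1))⁻¹ := by gcongr
    _ = (∑ q ∈ Finset.HasAntidiagonal.antidiagonal γ, (‖f q.1‖ * ‖g q.2‖) ^ 2) *
          (twoN γ ^ p)⁻¹ := by
        rw [pow_succ]
        field_simp
    _ = _ := by
        rw [Finset.sum_mul]
        refine Finset.sum_congr rfl fun q hq => ?_
        rw [← Finset.HasAntidiagonal.mem_antidiagonal.1 hq, twoN_add, mul_pow, mul_pow, mul_inv]
        ring

namespace HPrime

theorem summable {p : ℕ} (f : HPrime p) : Summable fun α => ‖series f α‖ ^ 2 * (twoN α ^ p)⁻¹ :=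
  f.2

theorem series_injective {p : ℕ} : Function.Injective (series (p := p)) :=
  Subtype.val_injective

theorem summable_prod {p : ℕ} (f g : HPrime p) :
    Summable fun q : (ℕ →₀ ℕ) × (ℕ →₀ ℕ) =>
      (‖series f q.1‖ ^ 2 * (twoN q.1 ^ p)⁻¹) * (‖series g q.2‖ ^ 2 * (twoN q.2 ^ p)⁻¹) := by
  refine f.summable.mul_of_nonneg g.summable (fun α => ?_) fun α => ?_ <;>
  · have := twoN_pos α
    positivity

theorem wick_mem {p : ℕ} (f g : HPrime p) :
    wick (series f) (series g) ∈ hPrimeSubmodule (p + 1) := by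
  refine Summable.of_nonneg_of_le (fun γ => ?_) (norm_wick_sq_mul_le p _ _)
    (summable_sum_mul_antidiagonal_of_summable_mul
      (f := fun α => ‖series f α‖ ^ 2 * (twoN α ^ p)⁻¹)
      (g := fun α => ‖series g α‖ ^ 2 * (twoN α ^ p)⁻¹) (summable_prod f g))
  have := twoN_pos γ
  positivity

/-- The Wick product `𝓗_p' × 𝓗_p' → 𝓗_{p+1}'`. -/
def wickMul {p : ℕ} (f g : HPrime p) : HPrime (p + 1) := ⟨wick (series f) (series g), wick_mem f g⟩

theorem series_wickMul {p : ℕ} (f g : HPrime p) :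
    series (wickMul f g) = wick (series f) (series g) := rfl

theorem norm_wickMul_le {p : ℕ} (f g : HPrime p) : ‖wickMul f g‖ ≤ ‖f‖ * ‖g‖ := by
  refine le_of_sq_le_sq ?_ (by positivity)
  have hs := summable_sum_mul_antidiagonal_of_summable_mul
      (f := fun α => ‖series f α‖ ^ 2 * (twoN α ^ p)⁻¹)
      (g := fun α => ‖series g α‖ ^ 2 * (twoN α ^ p)⁻¹) (summable_prod f g)
  rw [mul_pow, norm_sq, norm_sq, norm_sq,
    f.summable.tsum_mul_tsum_eq_tsum_sum_antidiagonal g.summable (summable_prod f g)]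
  exact (wickMul f g).summable.tsum_le_tsum (norm_wick_sq_mul_le p _ _) hs

/-- The Wick product as a continuous bilinear map `𝓗_p' × 𝓗_p' → 𝓗_{p+1}'`. -/
def wickCLM (p : ℕ) : HPrime p →L[ℂ] HPrime p →L[ℂ] HPrime (p + 1) :=
  LinearMap.mkContinuous₂ (LinearMap.mk₂ ℂ wickMul
    (fun f₁ f₂ g => series_injective (funext fun γ => by
      simp [series_wickMul, wick, add_mul, Finset.sum_add_distrib]))
    (fun c f g => series_injective (funext fun γ => by
      simp [series_wickMul, wick, Finset.mul_sum, mul_assoc]))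
    (fun f g₁ g₂ => series_injective (funext fun γ => by
      simp [series_wickMul, wick, mul_add, Finset.sum_add_distrib]))
    (fun c f g => series_injective (funext fun γ => by
      simp [series_wickMul, wick, Finset.mul_sum, mul_left_comm]))) 1
    fun f g => by simpa using norm_wickMul_le f g

end HPrime

/-! ### The inclusion of `L²(𝓢', P)` into `𝓗_p'` for `p ≥ 2` -/

theorem summable_inv_twoN_pow {p : ℕ} (hp : 2 ≤ p) : Summable fun α => (twoN α ^ p)⁻¹ := by
  refine Summable.of_nonneg_of_le (fun α => ?_) (fun α => ?_) summable_inv_twoN_sq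
  · have := twoN_pos α
    positivity
  · have := twoN_pos α
    gcongr
    exact one_le_twoN α

section WhiteNoise

variable (P : Measure TemperedDual) [IsWhiteNoise P]

theorem norm_chaosCoeff_sq_mul_le (F : Lp ℂ 2 P) (p : ℕ) (α : ℕ →₀ ℕ) :
    ‖chaosCoeff P F α‖ ^ 2 * (twoN α ^ p)⁻¹ ≤ ‖F‖ ^ 2 * (twoN α ^ p)⁻¹ := by
  have := twoN_pos α
  gcongr
  exact norm_chaosCoeff_le P F α

theorem chaosCoeff_mem {p : ℕ} (hp : 2 ≤ p) (F : Lp ℂ 2 P) :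
    chaosCoeff P F ∈ hPrimeSubmodule p := by
  refine Summable.of_nonneg_of_le (fun α => ?_) (norm_chaosCoeff_sq_mul_le P F p)
    ((summable_inv_twoN_pow hp).mul_left _)
  have := twoN_pos α
  positivity

/-- The inclusion of `L²(𝓢', P)` into `𝓗_p'`. -/
def chaosCLM {p : ℕ} (hp : 2 ≤ p) : Lp ℂ 2 P →L[ℂ] HPrime p :=
  LinearMap.mkContinuous
    { toFun := fun F => (⟨chaosCoeff P F, chaosCoeff_mem P hp F⟩ : HPrime p)
      map_add' := fun F G => HPrime.series_injective (chaosCoeff_add P F G)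
      map_smul' := fun c F => HPrime.series_injective (chaosCoeff_smul P c F) }
    (Real.sqrt (∑' α, (twoN α ^ p)⁻¹)) fun F => by
      have hs := summable_inv_twoN_pow hp
      refine le_of_sq_le_sq ?_ (by positivity)
      rw [mul_pow, Real.sq_sqrt (tsum_nonneg fun α => by have := twoN_pos α; positivity),
        HPrime.norm_sq, mul_comm, ← tsum_mul_left]
      exact (HPrime.summable _).tsum_le_tsum (norm_chaosCoeff_sq_mul_le P F p) (hs.mul_left _)

theorem series_chaosCLM {p : ℕ} (hp : 2 ≤ p) (F : Lp ℂ 2 P) :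
    HPrime.series (chaosCLM P hp F) = chaosCoeff P F := rfl

end WhiteNoise


/-! ### Strongly continuous families in `S₋₁`

The strong topology is used through the bounded sets of test functions `c_α H_α / α!` with rapidly
decreasing `c`. -/

/-- The test function `c H_α / α!`. -/
def testSingle (α : ℕ →₀ ℕ) (c : ℝ) : KondratievTest :=
  ⟨Pi.single α ((c / multiFactorial α : ℝ) : ℂ), fun k => by
    refine summable_of_ne_finset_zero (s := {α}) fun β hβ => ?_
    rw [Pi.single_eq_of_ne (by simpa using hβ)]
    simp⟩

theorem testSingle_self (α : ℕ →₀ ℕ) (c : ℝ) :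
    (testSingle α c).1 α = ((c / multiFactorial α : ℝ) : ℂ) := Pi.single_eq_same _ _

theorem testSingle_of_ne {α β : ℕ →₀ ℕ} (h : β ≠ α) (c : ℝ) : (testSingle α c).1 β = 0 :=
  Pi.single_eq_of_ne h _

/-- The `α!` of the pairing cancels, so these test functions read off single coefficients.
Uniformity over a bounded set of them thus controls all coefficients simultaneously. -/
theorem kondratievPairing_testSingle (f : KondratievDist) (α : ℕ →₀ ℕ) (c : ℝ) :
    kondratievPairing f (testSingle α c) = f.1 α * c := by
  have h0 : (multiFactorial α : ℂ) ≠ 0 := by exact_mod_cast (multiFactorial_pos α).ne'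
  rw [kondratievPairing, tsum_eq_single α fun β hβ => by rw [testSingle_of_ne hβ, mul_zero],
    testSingle_self]
  push_cast
  field_simp

/-- A real multi-sequence decreasing faster than every power of `(2ℕ)^α`. -/
def IsRapidlyDecreasing (c : (ℕ →₀ ℕ) → ℝ) : Prop :=
  ∀ k : ℕ, ∃ C : ℝ, ∀ α, |c α| * twoN α ^ k ≤ C

theorem isBoundedTest_range_testSingle {c : (ℕ →₀ ℕ) → ℝ} (hc : IsRapidlyDecreasing c) :
    IsBoundedTest (Set.range fun α => testSingle α (c α)) := by
  intro k
  obtain ⟨C, hC⟩ := hc k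
  refine ⟨C ^ 2, ?_⟩
  rintro _ ⟨α, rfl⟩
  have h0 := twoN_pos α
  have h1 := multiFactorial_pos α
  rw [tsum_eq_single α fun β hβ => by rw [testSingle_of_ne hβ]; simp, testSingle_self,
    Complex.norm_real, Real.norm_eq_abs, sq_abs]
  have h2 : 1 ≤ twoN α ^ k := one_le_pow₀ (one_le_twoN α)
  calc multiFactorial α ^ 2 * (c α / multiFactorial α) ^ 2 * twoN α ^ k
      = |c α| ^ 2 * twoN α ^ k := by
        rw [sq_abs]
        field_simp
    _ ≤ |c α| ^ 2 * (twoN α ^ k) ^ 2 := by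
        gcongr
        exact le_self_pow₀ h2 two_ne_zero
    _ = (|c α| * twoN α ^ k) ^ 2 := by ring
    _ ≤ C ^ 2 := by
        gcongr
        exact hC α

theorem tendstoUniformlyOn_kondratievPairing {X : Type*} [TopologicalSpace X]
    {Y : X → KondratievDist} {s : Set X} {t₀ : X} (hY : ContinuousWithinAt Y s t₀) {B : Set KondratievTest}
    (hB : IsBoundedTest B) :
    TendstoUniformlyOn (fun t => kondratievPairing (Y t)) (kondratievPairing (Y t₀))
      (nhdsWithin t₀ s) B := by
  have h : Tendsto Y (nhdsWithin t₀ s) (nhds (Y t₀)) := hY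
  rw [nhds_induced, tendsto_comap_iff, UniformOnFun.tendsto_iff_tendstoUniformlyOn] at h
  exact h B hB

theorem eventually_norm_sub_mul_lt {X : Type*} [TopologicalSpace X] {Y : X → KondratievDist}
    {s : Set X} {t₀ : X} (hY : ContinuousWithinAt Y s t₀) {c : (ℕ →₀ ℕ) → ℝ}
    (hc : IsRapidlyDecreasing c) {ε : ℝ} (hε : 0 < ε) :
    ∀ᶠ t in nhdsWithin t₀ s, ∀ α, ‖(Y t).1 α - (Y t₀).1 α‖ * |c α| < ε := by
  have h := Metric.tendstoUniformlyOn_iff.1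
    (tendstoUniformlyOn_kondratievPairing hY (isBoundedTest_range_testSingle hc)) ε hε
  filter_upwards [h] with t ht α
  have := ht _ ⟨α, rfl⟩
  rwa [kondratievPairing_testSingle, kondratievPairing_testSingle, dist_eq_norm', ← sub_mul,
    norm_mul, Complex.norm_real, Real.norm_eq_abs] at this

theorem continuousWithinAt_coeff {X : Type*} [TopologicalSpace X] {Y : X → KondratievDist}
    {s : Set X} {t₀ : X} (hY : ContinuousWithinAt Y s t₀) (α : ℕ →₀ ℕ) :
    ContinuousWithinAt (fun t => (Y t).1 α) s t₀ := by
  classical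
  have hc : IsRapidlyDecreasing (Pi.single α 1) := fun k => by
    refine ⟨twoN α ^ k, fun β => ?_⟩
    by_cases h : β = α
    · subst h
      simp
    · rw [Pi.single_eq_of_ne h]
      have := twoN_pos α
      simp only [abs_zero, zero_mul]
      positivity
  refine Metric.tendsto_nhds.2 fun ε hε => ?_
  filter_upwards [eventually_norm_sub_mul_lt hY hc hε] with t ht
  have := ht α
  rw [dist_eq_norm]
  simpa using this

theorem KondratievDist.exists_norm_coeff_le (f : KondratievDist) :
    ∃ (q : ℕ) (C : ℝ), ∀ α, ‖f.1 α‖ ≤ C * twoN α ^ q := by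
  obtain ⟨p, -, hp⟩ := f.2
  have hp' : Summable fun α => ‖f.1 α‖ ^ 2 * (twoN α ^ p)⁻¹ := hp
  set C := ∑' α, ‖f.1 α‖ ^ 2 * (twoN α ^ p)⁻¹
  -- A single term of the series is at most its sum `C`; passing to `C + 1` ensures `C ≤ (C + 1)²`.
  refine ⟨p, C + 1, fun α => ?_⟩
  have h0 := twoN_pos α
  have h1 : ‖f.1 α‖ ^ 2 * (twoN α ^ p)⁻¹ ≤ C := hp'.le_tsum α fun β _ => by
    have := twoN_pos β
    positivity
  have hC : 0 ≤ C := le_trans (by positivity) h1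
  have h2 : 1 ≤ twoN α ^ p := one_le_pow₀ (one_le_twoN α)
  rw [← div_eq_mul_inv, div_le_iff₀ (by positivity)] at h1
  refine le_of_sq_le_sq (h1.trans ?_) (by positivity)
  rw [mul_pow]
  refine mul_le_mul (by nlinarith) (le_self_pow₀ h2 two_ne_zero) (by positivity) (by positivity)

/-- Near `t₀` the weighted coefficients are within `1` of those of `Y t₀`, which grow at most like a
power of `(2ℕ)^α` and are tamed by `c`. Compactness makes the local bounds global. -/
theorem exists_norm_mul_rapid_le {X : Type*} [TopologicalSpace X] {Y : X → KondratievDist}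
    {s : Set X} (hs : IsCompact s) (hY : ContinuousOn Y s) {c : (ℕ →₀ ℕ) → ℝ}
    (hc : IsRapidlyDecreasing c) : ∃ M : ℝ, ∀ t ∈ s, ∀ α, ‖(Y t).1 α‖ * |c α| ≤ M := by
  refine hs.induction_on (p := fun s => ∃ M : ℝ, ∀ t ∈ s, ∀ α, ‖(Y t).1 α‖ * |c α| ≤ M)
    ⟨0, by simp⟩ ?_ ?_ ?_
  · rintro s t hst ⟨M, hM⟩
    exact ⟨M, fun x hx => hM x (hst hx)⟩
  · rintro s t ⟨M, hM⟩ ⟨N, hN⟩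
    refine ⟨max M N, fun x hx α => ?_⟩
    rcases hx with hx | hx
    · exact (hM x hx α).trans (le_max_left _ _)
    · exact (hN x hx α).trans (le_max_right _ _)
  · intro t₀ ht₀
    obtain ⟨q, C, hC⟩ := (Y t₀).exists_norm_coeff_le
    obtain ⟨D, hD⟩ := hc q
    have hC0 : 0 ≤ C := by
      have := (norm_nonneg _).trans (hC 0)
      exact nonneg_of_mul_nonneg_left this (pow_pos (twoN_pos 0) q)
    refine ⟨_, eventually_norm_sub_mul_lt (hY t₀ ht₀) hc one_pos, 1 + C * D, fun t ht α => ?_⟩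
    calc ‖(Y t).1 α‖ * |c α|
        ≤ (‖(Y t).1 α - (Y t₀).1 α‖ + ‖(Y t₀).1 α‖) * |c α| := by
          gcongr
          exact norm_le_norm_sub_add _ _
      _ = ‖(Y t).1 α - (Y t₀).1 α‖ * |c α| + ‖(Y t₀).1 α‖ * |c α| := add_mul _ _ _
      _ ≤ 1 + (C * twoN α ^ q) * |c α| :=
          add_le_add (ht α).le (mul_le_mul_of_nonneg_right (hC α) (abs_nonneg _))
      _ = 1 + C * (|c α| * twoN α ^ q) := by ring
      _ ≤ 1 + C * D := by
          gcongr
          exact hD α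

/-- If no bound held, each `q` would give a point `τ q` and an index `A q` with coefficient larger
than `q (2ℕ)^{q A_q}`. Weights of size `(2ℕ)^{-q A_q}` at the `A q` decrease rapidly, so the
weighted coefficients are bounded by some `M`, which fails for `q ≥ M`. -/
theorem exists_norm_coeff_le_of_isCompact {X : Type*} [TopologicalSpace X]
    {Y : X → KondratievDist} {s : Set X} (hs : IsCompact s) (hY : ContinuousOn Y s) :
    ∃ (q : ℕ) (C : ℝ), ∀ t ∈ s, ∀ α, ‖(Y t).1 α‖ ≤ C * twoN α ^ q := by
  classical
  by_contra! h
  choose τ hτ A hA using fun q : ℕ => h q q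
  -- Several `q` may share one index. The least of them gives the largest weight, so `c (A q) ≥
  -- (2ℕ)^{-q A_q}` for every `q`.
  set c : (ℕ →₀ ℕ) → ℝ := fun α =>
    if h : ∃ q, A q = α then (twoN α ^ Nat.find h)⁻¹ else 0 with hcdef
  have hc : IsRapidlyDecreasing c := fun k => by
    have hpos : ∀ q ∈ Finset.range k, 0 ≤ twoN (A q) ^ k := fun q _ => by
      have := twoN_pos (A q)
      positivity
    -- The `1` serves the indices whose least `q` is at least `k`; the sum serves the finitely many
    -- others.
    refine ⟨1 + ∑ q ∈ Finset.range k, twoN (A q) ^ k, fun α => ?_⟩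
    have h0 := twoN_pos α
    have hsum := Finset.sum_nonneg hpos
    by_cases hα : ∃ q, A q = α
    · have h1 : |c α| = (twoN α ^ Nat.find hα)⁻¹ := by
        rw [hcdef]
        simp only [dif_pos hα]
        exact abs_of_pos (by positivity)
      rw [h1]
      rcases lt_or_ge (Nat.find hα) k with hk | hk
      · have h2 : (twoN α ^ Nat.find hα)⁻¹ ≤ 1 :=
          inv_le_one_of_one_le₀ (one_le_pow₀ (one_le_twoN α))
        have h3 := Finset.single_le_sum hpos (Finset.mem_range.2 hk)
        rw [Nat.find_spec hα] at h3
        nlinarith [pow_pos h0 k]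
      · have h2 : (twoN α ^ Nat.find hα)⁻¹ * twoN α ^ k ≤ 1 := by
          rw [inv_mul_le_iff₀ (by positivity), mul_one]
          exact pow_le_pow_right₀ (one_le_twoN α) hk
        linarith
    · have h1 : c α = 0 := by
        rw [hcdef]
        simp only [dif_neg hα]
      rw [h1, abs_zero, zero_mul]
      linarith
  obtain ⟨M, hM⟩ := exists_norm_mul_rapid_le hs hY hc
  obtain ⟨q, hq⟩ := exists_nat_ge M
  have h0 := twoN_pos (A q)
  have h1 : (twoN (A q) ^ q)⁻¹ ≤ |c (A q)| := by
    have hex : ∃ r, A r = A q := ⟨q, rfl⟩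
    rw [hcdef]
    simp only [dif_pos hex]
    rw [abs_of_pos (by positivity)]
    have := one_le_twoN (A q)
    gcongr
    exact Nat.find_min' hex rfl
  have h2 := hA q
  rw [← lt_div_iff₀ (by positivity), div_eq_mul_inv] at h2
  have h3 := hM (τ q) (hτ q) (A q)
  have h4 := mul_le_mul_of_nonneg_left h1 (norm_nonneg ((Y (τ q)).1 (A q)))
  linarith

/-- Dominated convergence for series: `2q` powers of the weight absorb the squared growth of the
coefficients, and two more make the majorant summable. -/
theorem HPrime.tendsto_of_tendsto_coeff {X : Type*} {l : Filter X} {q p : ℕ}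
    (hp : 2 * q + 2 ≤ p) {C : ℝ} {y : X → HPrime p} {y₀ : HPrime p}
    (hy : ∀ᶠ t in l, ∀ α, ‖series (y t) α‖ ≤ C * twoN α ^ q)
    (hy₀ : ∀ α, ‖series y₀ α‖ ≤ C * twoN α ^ q)
    (hlim : ∀ α, Tendsto (fun t => series (y t) α) l (nhds (series y₀ α))) :
    Tendsto y l (nhds y₀) := by
  rw [tendsto_iff_norm_sub_tendsto_zero]
  have h : Tendsto (fun t => ‖y t - y₀‖ ^ 2) l (nhds 0) := by
    simp only [norm_sq]
    have h0 : (0 : ℝ) = ∑' α : ℕ →₀ ℕ, (0 : ℝ) := tsum_zero.symm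
    rw [h0]
    refine tendsto_tsum_of_dominated_convergence
      (bound := fun α => (2 * C) ^ 2 * (twoN α ^ 2)⁻¹) (summable_inv_twoN_sq.mul_left _)
      (fun α => ?_) ?_
    · have h1 := (((hlim α).sub_const (series y₀ α)).norm.pow 2).mul_const (twoN α ^ p)⁻¹
      simpa using h1
    · filter_upwards [hy] with t ht α
      have h0 := twoN_pos α
      have h1 : ‖series (y t - y₀) α‖ ≤ 2 * C * twoN α ^ q := by
        rw [map_sub, Pi.sub_apply]
        refine (norm_sub_le _ _).trans ?_
        linarith [ht α, hy₀ α]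
      rw [Real.norm_of_nonneg (by positivity)]
      calc ‖series (y t - y₀) α‖ ^ 2 * (twoN α ^ p)⁻¹
          ≤ (2 * C * twoN α ^ q) ^ 2 * (twoN α ^ (2 * q + 2))⁻¹ := by
            gcongr
            exact one_le_twoN α
        _ = (2 * C) ^ 2 * (twoN α ^ 2)⁻¹ := by
            rw [pow_add, mul_pow, ← pow_mul, mul_comm q]
            field_simp
  have h2 := h.sqrt
  simpa only [Real.sqrt_sq (norm_nonneg _), Real.sqrt_zero] using h2

/-- A family that is strongly continuous on a compact set is a norm continuous family in one of the
spaces `𝓗_p'`. -/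
theorem exists_continuousOn_hPrime {X : Type*} [TopologicalSpace X] {Y : X → KondratievDist}
    {s : Set X} (hs : IsCompact s) (hY : ContinuousOn Y s) :
    ∃ p : ℕ, 2 ≤ p ∧ ∃ y : X → HPrime p,
      (∀ t ∈ s, HPrime.series (y t) = (Y t).1) ∧ ContinuousOn y s := by
  classical
  obtain ⟨q, C, hC⟩ := exists_norm_coeff_le_of_isCompact hs hY
  have hmem : ∀ t ∈ s, (Y t).1 ∈ hPrimeSubmodule (2 * q + 2) := fun t ht => by
    refine Summable.of_nonneg_of_le (fun α => ?_) (fun α => ?_)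
      (summable_inv_twoN_sq.mul_left (C ^ 2))
    · have := twoN_pos α
      positivity
    · have h0 := twoN_pos α
      calc ‖(Y t).1 α‖ ^ 2 * (twoN α ^ (2 * q + 2))⁻¹
          ≤ (C * twoN α ^ q) ^ 2 * (twoN α ^ (2 * q + 2))⁻¹ := by
            gcongr
            exact hC t ht α
        _ = C ^ 2 * (twoN α ^ 2)⁻¹ := by
            rw [pow_add, mul_pow, ← pow_mul, mul_comm q]
            field_simp
  -- The value `0` off `s` is arbitrary; only the restriction to `s` matters.
  set y : X → HPrime (2 * q + 2) := fun t => if ht : t ∈ s then ⟨(Y t).1, hmem t ht⟩ else 0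
  have hy : ∀ t ∈ s, HPrime.series (y t) = (Y t).1 := fun t ht => by
    have h : y t = (⟨(Y t).1, hmem t ht⟩ : HPrime (2 * q + 2)) := dif_pos ht
    rw [h]
    rfl
  refine ⟨2 * q + 2, by omega, y, hy, fun t₀ ht₀ => ?_⟩
  refine HPrime.tendsto_of_tendsto_coeff (C := C) le_rfl ?_ (by rw [hy t₀ ht₀]; exact hC t₀ ht₀)
    fun α => ?_
  · filter_upwards [self_mem_nhdsWithin] with t ht
    rw [hy t ht]
    exact hC t ht
  · rw [hy t₀ ht₀]
    refine (continuousWithinAt_coeff (hY t₀ ht₀) α).tendsto.congr' ?_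
    filter_upwards [self_mem_nhdsWithin] with t ht
    rw [hy t ht]


/-! ### The process `X_σ` is continuously differentiable in `L²(𝓢', P)` -/

theorem norm_toLp_sq {X : Type*} [MeasurableSpace X] {μ : Measure X} {f : X → ℂ}
    (hf : MemLp f 2 μ) : ‖hf.toLp‖ ^ 2 = ∫ x, ‖f x‖ ^ 2 ∂μ := by
  rw [Lp.norm_toLp, hf.eLpNorm_eq_integral_rpow_norm (by simp) (by simp),
    ENNReal.toReal_ofReal (by positivity), ← Real.rpow_natCast, ← Real.rpow_mul
      (integral_nonneg fun x => by positivity)]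
  simp

theorem tendsto_toLp_of_bounded {X ι : Type*} [MeasurableSpace X] {μ : Measure X}
    [IsFiniteMeasure μ] {l : Filter ι} [l.IsCountablyGenerated] {F : ι → X → ℂ} {g : X → ℂ}
    (hF : ∀ i, MemLp (F i) 2 μ) (hg : MemLp g 2 μ) {C : ℝ}
    (hb : ∀ᶠ i in l, ∀ x, ‖F i x - g x‖ ≤ C)
    (hlim : ∀ x, Tendsto (fun i => F i x) l (nhds (g x))) :
    Tendsto (fun i => (hF i).toLp) l (nhds hg.toLp) := by
  rw [tendsto_iff_norm_sub_tendsto_zero]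
  have h : Tendsto (fun i => ‖(hF i).toLp - hg.toLp‖ ^ 2) l (nhds 0) := by
    have h1 : ∀ i, ‖(hF i).toLp - hg.toLp‖ ^ 2 = ∫ x, ‖F i x - g x‖ ^ 2 ∂μ := fun i => by
      rw [← MemLp.toLp_sub, norm_toLp_sq]
      rfl
    simp only [h1]
    have h0 : (0 : ℝ) = ∫ _ : X, (0 : ℝ) ∂μ := by simp
    rw [h0]
    refine tendsto_integral_filter_of_dominated_convergence (fun _ => C ^ 2)
      (Eventually.of_forall fun i => ?_) ?_ (integrable_const _) (Eventually.of_forall fun x => ?_)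
    · exact ((hF i).1.sub hg.1).norm.pow 2
    · filter_upwards [hb] with i hi
      refine Eventually.of_forall fun x => ?_
      rw [Real.norm_of_nonneg (by positivity)]
      exact pow_le_pow_left₀ (norm_nonneg _) (hi x) 2
    · have h2 := ((hlim x).sub_const (g x)).norm.pow 2
      simpa using h2
  have h2 := h.sqrt
  simpa only [Real.sqrt_sq (norm_nonneg _), Real.sqrt_zero] using h2

section Spectral

variable (σ : Measure ℝ) [IsFiniteMeasure σ]

theorem memLp_exp (t : ℝ) :
    MemLp (fun u : ℝ => Complex.exp (Complex.I * (t : ℂ) * (u : ℂ))) 2 σ :=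
  MemLp.of_bound (by fun_prop) 1 (Eventually.of_forall fun u => (norm_exp_I_mul t u).le)

theorem expL2_eq (t : ℝ) : expL2 σ t = (memLp_exp σ t).toLp := rfl

theorem continuous_expL2 : Continuous (expL2 σ) := by
  refine continuous_iff_continuousAt.2 fun t => ?_
  refine tendsto_toLp_of_bounded (C := 2) (memLp_exp σ) (memLp_exp σ t)
    (Eventually.of_forall fun s u => (norm_sub_le _ _).trans ?_) fun u => ?_
  · rw [norm_exp_I_mul, norm_exp_I_mul]
    norm_num
  · have h : Continuous fun s : ℝ => Complex.exp (Complex.I * (s : ℂ) * (u : ℂ)) := by fun_prop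
    exact h.tendsto t

theorem fourierHat_indicatorZero (t u : ℝ) :
    fourierHat (indicatorZero t) u =
      ∫ x in (0 : ℝ)..t, Complex.exp (Complex.I * (u : ℂ) * (x : ℂ)) := by
  have hc : Continuous fun x : ℝ => Complex.exp (Complex.I * (u : ℂ) * (x : ℂ)) := by fun_prop
  have hi : ∀ a b : ℝ, Integrable
      ((Set.Ioc a b).indicator fun x : ℝ => Complex.exp (Complex.I * (u : ℂ) * (x : ℂ))) :=
    fun a b => (integrable_indicator_iff measurableSet_Ioc).2
      (hc.integrableOn_Icc.mono_set Set.Ioc_subset_Icc_self)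
  have h : ∀ x : ℝ, Complex.exp (Complex.I * (u : ℂ) * (x : ℂ)) * indicatorZero t x =
      (Set.Ioc 0 t).indicator (fun x : ℝ => Complex.exp (Complex.I * (u : ℂ) * (x : ℂ))) x -
      (Set.Ioc t 0).indicator (fun x : ℝ => Complex.exp (Complex.I * (u : ℂ) * (x : ℂ))) x := by
    intro x
    simp only [indicatorZero, Set.indicator_apply, Pi.one_apply]
    split_ifs <;> ring
  rw [fourierHat]
  simp only [h]
  rw [integral_sub (hi _ _) (hi _ _), integral_indicator measurableSet_Ioc,
    integral_indicator measurableSet_Ioc]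
  rfl

/-- For fixed `u` this is the fundamental theorem of calculus for `∫₀ᵗ e^{iux} dx`. The difference
quotients have modulus at most `1` and `σ` is finite, so pointwise convergence gives convergence in
`L²(dσ)`. -/
theorem hasDerivAt_fourierHat_indicatorZero (t : ℝ) :
    HasDerivAt (fun t => (memLp_fourierHat σ (integrable_indicatorZero t)).toLp)
      (expL2 σ t) t := by
  have hc : ∀ u : ℝ, Continuous fun x : ℝ => Complex.exp (Complex.I * (u : ℂ) * (x : ℂ)) :=
    fun u => by fun_prop
  rw [hasDerivAt_iff_tendsto_slope, expL2_eq]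
  have hm : ∀ s : ℝ, MemLp (fun u => slope (fun s => fourierHat (indicatorZero s) u) t s) 2 σ :=
    fun s => ((memLp_fourierHat σ (integrable_indicatorZero s)).sub
      (memLp_fourierHat σ (integrable_indicatorZero t))).const_smul (s - t)⁻¹
  refine (tendsto_toLp_of_bounded (C := 2) hm (memLp_exp σ t)
    (Eventually.of_forall fun s u => (norm_sub_le _ _).trans ?_) fun u => ?_).congr fun s => ?_
  · have h1 : ‖slope (fun s => fourierHat (indicatorZero s) u) t s‖ ≤ 1 := by
      rw [slope_def_module, fourierHat_indicatorZero, fourierHat_indicatorZero,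
        intervalIntegral.integral_interval_sub_left ((hc u).intervalIntegrable _ _)
          ((hc u).intervalIntegrable _ _), norm_smul, norm_inv, Real.norm_eq_abs]
      have h2 := intervalIntegral.norm_integral_le_of_norm_le_const (a := t) (b := s) (C := 1)
        (f := fun x : ℝ => Complex.exp (Complex.I * (u : ℂ) * (x : ℂ)))
        fun x _ => (norm_exp_I_mul u x).le
      rw [one_mul] at h2
      exact (mul_le_mul_of_nonneg_left h2 (by positivity)).trans inv_mul_le_one
    rw [norm_exp_I_mul]
    linarith
  · have h1 := ((hc u).integral_hasStrictDerivAt 0 t).hasDerivAt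
    have h2 := hasDerivAt_iff_tendsto_slope.1 h1
    simp only [fourierHat_indicatorZero]
    rwa [mul_right_comm] at h2
  · rw [slope_def_module, ← MemLp.toLp_sub, ← MemLp.toLp_const_smul]
    rfl

variable {lam : ℕ → ℝ}

/-- For a spectral pair, `spectralMap` is an isometry. -/
theorem IsSpectralPair.exists_spectralMap_eq {σ : Measure ℝ} [IsFiniteMeasure σ]
    (h : IsSpectralPair σ lam) :
    ∃ U : Lp ℂ 2 σ →ₗᵢ[ℂ] Lp ℂ 2 (volume : Measure ℝ), ∀ φ, spectralMap σ lam φ = U φ := by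
  -- The coefficients in the basis `e_{λ_n}` form an `ℓ²` sequence, which the orthonormal `h_n` sum
  -- isometrically.
  let b := HilbertBasis.mk h.orthonormal h.complete.ge
  have hV := orthonormal_hermiteL2.orthogonalFamily
  refine ⟨hV.linearIsometry.comp b.repr.toLinearIsometry, fun φ => ?_⟩
  refine Eq.trans (tsum_congr fun n => ?_) (hV.linearIsometry_apply (b.repr φ)).symm
  rw [LinearIsometry.toSpanSingleton_apply, b.repr_apply_apply, HilbertBasis.coe_mk]

variable (P : Measure TemperedDual) [IsWhiteNoise P]

/-- `f ↦ f̃` on the complex space `L²(ℝ, dx)` as a real continuous linear map. -/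
def tildeCLM : Lp ℂ 2 (volume : Measure ℝ) →L[ℝ] Lp ℂ 2 P :=
  Complex.ofRealCLM.compLpL 2 P ∘L tilde P ∘L Complex.reCLM.compLpL 2 volume +
    Complex.I • (Complex.ofRealCLM.compLpL 2 P ∘L tilde P ∘L Complex.imCLM.compLpL 2 volume)

/-- A bounded real-linear map commutes with differentiation in the real variable `t`. Of `f ↦ f̃`
only continuity and real linearity enter. -/
theorem hasDerivAt_processX_and_continuous_processW (h : IsSpectralPair σ lam) :
    (∀ t, HasDerivAt (processX σ lam P) (processW σ lam P t) t) ∧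
      Continuous (processW σ lam P) := by
  obtain ⟨U, hU⟩ := h.exists_spectralMap_eq
  set Φ : Lp ℂ 2 σ →L[ℝ] Lp ℂ 2 P :=
    tildeCLM P ∘L U.toContinuousLinearMap.restrictScalars ℝ
  have hX : processX σ lam P =
      fun t => Φ (memLp_fourierHat σ (integrable_indicatorZero t)).toLp := by
    funext t
    rw [processX, Qop, hU]
    rfl
  have hd : ∀ t, HasDerivAt (processX σ lam P) (Φ (expL2 σ t)) t := fun t => by
    rw [hX]
    exact Φ.hasFDerivAt.comp_hasDerivAt t (hasDerivAt_fourierHat_indicatorZero σ t)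
  have hW : processW σ lam P = fun t => Φ (expL2 σ t) := funext fun t => (hd t).deriv
  refine ⟨fun t => ?_, ?_⟩
  · rw [hW]
    exact hd t
  · rw [hW]
    exact Φ.continuous.comp (continuous_expL2 σ)

end Spectral


/-! ### Riemann–Stieltjes sums -/

theorem mem_Icc_of_partition {a b : ℝ} {n : ℕ} {τ : ℕ → ℝ} (h0 : τ 0 = a) (hn : τ n = b)
    (hτ : ∀ k < n, τ k < τ (k + 1)) {k : ℕ} (hk : k ≤ n) : τ k ∈ Set.Icc a b := by
  have h1 : ∀ i j, i ≤ j → j ≤ n → τ i ≤ τ j := fun i j hij => by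
    induction j, hij using Nat.le_induction with
    | base => exact fun _ => le_rfl
    | succ j _ ih => exact fun hj => (ih (by omega)).trans (hτ j (by omega)).le
  exact ⟨h0 ▸ h1 0 k k.zero_le hk, hn ▸ h1 k n hk le_rfl⟩

/-- The Riemann–Stieltjes sums `∑ B(y(t_k), x(t_{k+1}) - x(t_k))` converge to `∫ B(y, x')` for
continuous `y`, `x'` and a continuous bilinear `B`. -/
theorem exists_norm_sum_sub_integral_lt {E F G : Type*} [NormedAddCommGroup E] [NormedSpace ℝ E]
    [NormedAddCommGroup F] [NormedSpace ℝ F] [CompleteSpace F]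
    [NormedAddCommGroup G] [NormedSpace ℝ G] [CompleteSpace G]
    (B : E →L[ℝ] F →L[ℝ] G) {a b : ℝ} (hab : a ≤ b) {y : ℝ → E} (hy : ContinuousOn y (Set.Icc a b))
    {x w : ℝ → F} (hx : ∀ t, HasDerivAt x (w t) t) (hw : Continuous w) {ε : ℝ} (hε : 0 < ε) :
    ∃ δ > 0, ∀ (n : ℕ) (τ : ℕ → ℝ), τ 0 = a → τ n = b →
      (∀ k < n, τ k < τ (k + 1)) → (∀ k < n, τ (k + 1) - τ k < δ) →
      ‖(∑ k ∈ Finset.range n, B (y (τ k)) (x (τ (k + 1)) - x (τ k))) -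
        ∫ t in a..b, B (y t) (w t)‖ < ε := by
  obtain ⟨M, hM⟩ := isCompact_Icc.exists_bound_of_continuousOn (s := Set.Icc a b) hw.continuousOn
  have hM0 : 0 ≤ M := (norm_nonneg _).trans (hM a ⟨le_rfl, hab⟩)
  -- The added `1` keeps `K` positive in degenerate cases and makes the final estimate strict.
  set K : ℝ := ‖B‖ * M * (b - a) + 1 with hK
  have hba : 0 ≤ b - a := sub_nonneg.2 hab
  have hK0 : 0 < K := by positivity
  have huc := isCompact_Icc.uniformContinuousOn_of_continuous hy
  obtain ⟨δ, hδ, hyδ⟩ := Metric.uniformContinuousOn_iff.1 huc (ε / K) (div_pos hε hK0)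
  refine ⟨δ, hδ, fun n τ h0 hn hτ hmesh => ?_⟩
  have hmem : ∀ k ≤ n, τ k ∈ Set.Icc a b := fun k hk => mem_Icc_of_partition h0 hn hτ hk
  have hcont : ContinuousOn (fun t => B (y t) (w t)) (Set.Icc a b) :=
    (B.continuous.comp_continuousOn hy).clm_apply hw.continuousOn
  have hsub : ∀ k < n, Set.uIcc (τ k) (τ (k + 1)) ⊆ Set.Icc a b := fun k hk => by
    rw [Set.uIcc_of_le (hτ k hk).le]
    exact Set.Icc_subset_Icc (hmem k hk.le).1 (hmem (k + 1) hk).2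
  have hint : ∀ k < n, IntervalIntegrable (fun t => B (y t) (w t)) volume (τ k) (τ (k + 1)) :=
    fun k hk => (hcont.mono (hsub k hk)).intervalIntegrable
  have hterm : ∀ k ∈ Finset.range n, ‖B (y (τ k)) (x (τ (k + 1)) - x (τ k)) -
      ∫ t in τ k..τ (k + 1), B (y t) (w t)‖ ≤ ‖B‖ * (ε / K) * M * (τ (k + 1) - τ k) := by
    intro k hk
    have hk := Finset.mem_range.1 hk
    have hwi := hw.intervalIntegrable (μ := volume) (τ k) (τ (k + 1))
    have h1 : x (τ (k + 1)) - x (τ k) = ∫ t in τ k..τ (k + 1), w t :=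
      (intervalIntegral.integral_eq_sub_of_hasDerivAt (fun t _ => hx t) hwi).symm
    have h2 : IntervalIntegrable (fun t => B (y (τ k)) (w t)) volume (τ k) (τ (k + 1)) :=
      ((B (y (τ k))).continuous.comp hw).intervalIntegrable _ _
    -- Both terms are now integrals over the same subinterval, with difference `∫ B(y(t_k) - y(t),
    -- w(t)) dt`.
    rw [h1, ← (B (y (τ k))).intervalIntegral_comp_comm hwi,
      ← intervalIntegral.integral_sub h2 (hint k hk)]
    refine (intervalIntegral.norm_integral_le_of_norm_le_const
      (C := ‖B‖ * (ε / K) * M) fun t ht => ?_).trans_eq ?_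
    · rw [Set.uIoc_of_le (hτ k hk).le] at ht
      have htm : t ∈ Set.Icc a b :=
        ⟨(hmem k hk.le).1.trans ht.1.le, ht.2.trans (hmem (k + 1) hk).2⟩
      have h3 : ‖y (τ k) - y t‖ ≤ ε / K := by
        rw [← dist_eq_norm]
        refine (hyδ _ (hmem k hk.le) _ htm ?_).le
        rw [dist_comm, Real.dist_eq, abs_of_pos (sub_pos.2 ht.1)]
        linarith [ht.2, hmesh k hk]
      have h4 : B (y (τ k)) (w t) - B (y t) (w t) = B (y (τ k) - y t) (w t) := by
        rw [map_sub, sub_apply]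
      rw [h4]
      refine (B.le_opNorm₂ _ _).trans ?_
      gcongr
      exact hM t htm
    · rw [abs_of_pos (sub_pos.2 (hτ k hk))]
  rw [← h0, ← hn, ← intervalIntegral.sum_integral_adjacent_intervals hint,
    ← Finset.sum_sub_distrib]
  calc ‖∑ k ∈ Finset.range n, (B (y (τ k)) (x (τ (k + 1)) - x (τ k)) -
        ∫ t in τ k..τ (k + 1), B (y t) (w t))‖
      ≤ ∑ k ∈ Finset.range n, ‖B‖ * (ε / K) * M * (τ (k + 1) - τ k) := norm_sum_le_of_le _ hterm
    _ = ε * ((‖B‖ * M * (b - a)) / K) := by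
        rw [← Finset.mul_sum, Finset.sum_range_sub, h0, hn]
        ring
    _ < ε * 1 := by
        refine mul_lt_mul_of_pos_left ?_ hε
        rw [div_lt_one hK0]
        linarith
    _ = ε := mul_one ε

end KondratievIto

end

/-! ### The Wick–Itô integral -/

open KondratievIto in
theorem theorem7p1 (σ : MeasureTheory.Measure ℝ) [MeasureTheory.IsFiniteMeasure σ]
    (lam : ℕ → ℝ) (hσ : IsSpectralPair σ lam)
    (P : MeasureTheory.Measure TemperedDual) [IsWhiteNoise P]
    (a b : ℝ) (hab : a ≤ b)
    (Y : ℝ → KondratievDist) (hY : ContinuousOn Y (Set.Icc a b)) :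
    ∃ p : ℕ, 1 ≤ p ∧ ∃ F : ℝ → HPrime p,
      (∀ t ∈ Set.Icc a b,
        HPrime.series (F t) = wick (Y t).1 (chaosCoeff P (processW σ lam P t))) ∧
      ContinuousOn F (Set.Icc a b) ∧
      ∀ ε > 0, ∃ δ > 0, ∀ (n : ℕ) (τ : ℕ → ℝ), τ 0 = a → τ n = b →
        (∀ k < n, τ k < τ (k + 1)) → (∀ k < n, τ (k + 1) - τ k < δ) →
        ∃ S : ℕ → HPrime p,
          (∀ k < n, HPrime.series (S k) =
            wick (Y (τ k)).1
              (chaosCoeff P (processX σ lam P (τ (k + 1)) - processX σ lam P (τ k)))) ∧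
          ‖(∑ k ∈ Finset.range n, S k) - ∫ t in a..b, F t‖ < ε := by
  obtain ⟨p, hp, y, hyY, hy⟩ := exists_continuousOn_hPrime isCompact_Icc hY
  obtain ⟨hX, hW⟩ := hasDerivAt_processX_and_continuous_processW σ P hσ
  -- The bound `2 ≤ p` lets one space hold both `Y` and the process; the Wick product then lands in
  -- `𝓗_{p+1}'`. Real scalars suffice for calculus in `t`.
  let J : MeasureTheory.Lp ℂ 2 P →L[ℝ] HPrime p := (chaosCLM P hp).restrictScalars ℝ
  let B : HPrime p →L[ℝ] HPrime p →L[ℝ] HPrime (p + 1) :=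
    (HPrime.wickCLM p).bilinearRestrictScalars ℝ
  have hJW : Continuous fun t => J (processW σ lam P t) := J.continuous.comp hW
  have hJX : ∀ t, HasDerivAt (fun t => J (processX σ lam P t)) (J (processW σ lam P t)) t :=
    fun t => J.hasFDerivAt.comp_hasDerivAt t (hX t)
  refine ⟨p + 1, by omega, fun t => B (y t) (J (processW σ lam P t)), fun t ht => ?_,
    (B.continuous.comp_continuousOn hy).clm_apply hJW.continuousOn, fun ε hε => ?_⟩
  · rw [← hyY t ht]
    rfl
  · obtain ⟨δ, hδ, h⟩ := exists_norm_sum_sub_integral_lt B hab hy hJX hJW hε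
    refine ⟨δ, hδ, fun n τ h0 hn hτ hmesh =>
      ⟨fun k => B (y (τ k)) (J (processX σ lam P (τ (k + 1))) - J (processX σ lam P (τ k))),
        fun k hk => ?_, h n τ h0 hn hτ hmesh⟩⟩
    rw [← hyY (τ k) (mem_Icc_of_partition h0 hn hτ hk.le), ← series_chaosCLM P hp,
      (chaosCLM P hp).map_sub]
    rfl
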